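/- Let $K$ be a number field of degree $4$ or $6$ with an automorphism $\sigma\neq\mathrm{id}$. Let $K^{\langle\sigma\rangle}$ be the fixed field of $\sigma$, $U=\mathcal O_K^\times$ the group of units, $U_{\rm tor}$ its torsion subgroup and $r$ the rank of $U$. Let $\mu_{\mathbb Z,\sigma}\in\mathbb Z[x]$ be the minimal polynomial of the endomorphism of $U/U_{\rm tor}\cong\mathbb Z^r$ induced by $\sigma$. Write $\operatorname{sign}$ for the signature (number of real places, number of complex places). For primes $p$, $\ell$ and an integer $n$, let $\mathfrak p$ be a prime ideal of $\mathcal O_K$ with residue field $\mathbb F_{p^n}$, let $\rho:\mathcal O_K\to\mathbb F_{p^n}$ be the reduction modulo $\mathfrak p$, and let $\log$ be the discrete logarithm in $\mathbb F_{p^n}^\times$ with respect to some generator. Assume that $\operatorname{ord}(\sigma)\mid n$ (for example $n=\operatorname{ord}(\sigma)$), that $\ell\mid\Phi_n(p)$, $\ell\nmid\operatorname{ord}(\sigma)$, that $K$ contains no root of unity of order $\ell$, and that $A\not\equiv1\pmod\ell$ is an integer such that $\log\rho(\sigma(x))\equiv A\log\rho(x)\pmod\ell$ for all $x\in\mathcal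 O_K$ of norm coprime to $p$. For $c\in\mathbb F_\ell$ let $E_c$ be the eigenspace for $c$ of $\sigma$ acting on the $\mathbb F_\ell$-vector space $U/U^\ell$, and let $\mathcal R$ be the dimension of $\sum_{c\neq A}E_c$, that is, the number of elements outside $E_A$ in a basis of $U/U^\ell$ made of eigenvectors of $\sigma$. Then: (1) If $[K:\mathbb Q]=6$ and $\operatorname{ord}(\sigma)=2$, assume that $\operatorname{sign}(K)=(0,3)$. Then $[K:\mathbb Q]$, $\operatorname{ord}(\sigma)$, $\operatorname{sign}(K)$, $\operatorname{sign}(K^{\langle\sigma\rangle})$ are those of one of the lines of the following table (where a dash means $K^{\langle\sigma\rangle}=\mathbb Q$). (2) In each line, $\mu_{\mathbb Z,\sigma}$ and $r$ have the values in the table, and for all $p,n,\ell,\mathfrak p,\log,A$ as above, $\mathcal R$ and $\dim E_A=r-\mathcal R$ have the values in the table. Moreover there are units $u_1,\dots,u_r$ whose classes form a basis of $U/U^\ell$ such that $u_1,\dots,u_{\mathcal R}$ are in eigenspaces $E_c$ with $c\ne A$ and $\log\rho(u_i)\equiv0\pmod\ell$ for $1\le i\le\mathcal R$, and $u_{\mathcal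 R+1},\dots,u_r$ are in $E_A$. $$\begin{array}{c|c|l|l|c|c|c} \deg K&\operatorname{ord}\sigma&\operatorname{sign}(K),\ \operatorname{sign}(K^{\langle\sigma\rangle})&\mu_{\mathbb Z,\sigma}&\mathcal R&r&r-\mathcal R\\\hline 4&2&(4,0),(2,0)&(x-1)(x+1)&1&3&2\\ 4&2&(2,1),(2,0)&(x-1)(x+1)&1&2&1\\ 4&2&(0,2),(0,1)&x+1&0&1&1\\ 4&2&(0,2),(2,0)&x-1&1&1&0\\ 4&4&(4,0),-&(x+1)(x^2+1)&2&3&1\\ 4&4&(0,2),-&x+1&1&1&0\\ 6&2&(0,3),(1,1)&(x-1)(x+1)&1&2&1\\ 6&2&(0,3),(3,0)&x-1&2&2&0\\ 6&3&(6,0),(2,0)&(x-1)(x^2+x+1)&3&5&2\\ 6&3&(0,3),(0,1)&x^2+x+1&1&2&1\\ 6&6&(6,0),-&(x+1)(x^2+x+1)(x^2-x+1)&4&5&1\\ 6&6&(0,3),-&x^2+x+1&2&2&0 \end{array}$$ -/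

import Mathlib

open NumberField Polynomial

noncomputable section

namespace NFSUnits

section Fields

variable {K : Type*} [Field K] [NumberField K]

/-- The action of an automorphism of `K` on the ring of integers. -/
def intAction (σ : K ≃ₐ[ℚ] K) : 𝓞 K →+* 𝓞 K :=
  RingOfIntegers.mapRingHom (σ : K →+* K)

/-- The action of an automorphism of `K` on the group `U` of units. -/
def unitAction (σ : K ≃ₐ[ℚ] K) : (𝓞 K)ˣ →* (𝓞 K)ˣ :=
  Units.map (intAction σ : 𝓞 K →* 𝓞 K)

theorem torsion_le_comap (σ : K ≃ₐ[ℚ] K) :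
    Units.torsion K ≤ (Units.torsion K).comap (unitAction σ) := fun _ hu =>
  MonoidHom.isOfFinOrder (unitAction σ) hu

variable (K) in
/-- The free abelian group `U / U_tor`, written additively. -/
abbrev UnitsModTorsion : Type _ := Additive ((𝓞 K)ˣ ⧸ Units.torsion K)

instance : AddCommGroup (UnitsModTorsion K) := Additive.addCommGroup

/-- The endomorphism of `U / U_tor` induced by `σ`. -/
def actionModTorsion (σ : K ≃ₐ[ℚ] K) : Module.End ℤ (UnitsModTorsion K) :=
  (MonoidHom.toAdditive
    (QuotientGroup.map (Units.torsion K) (Units.torsion K) (unitAction σ)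
      (torsion_le_comap σ))).toIntLinearMap

/-- The minimal polynomial over `ℤ` of `σ` acting on `U / U_tor`. -/
def unitMinpoly (σ : K ≃ₐ[ℚ] K) : ℤ[X] := minpoly ℤ (actionModTorsion σ)

variable (K) in
/-- The `𝔽_ℓ`-vector space `U / U^ℓ`, written additively. -/
abbrev UnitsMod (ℓ : ℕ) : Type _ := ModN (Additive (𝓞 K)ˣ) ℓ

/-- The class of a unit in `U / U^ℓ`. -/
def unitClass (ℓ : ℕ) (u : (𝓞 K)ˣ) : UnitsMod K ℓ := ModN.mkQ ℓ (Additive.ofMul u)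

theorem range_le_comap (σ : K ≃ₐ[ℚ] K) (ℓ : ℕ) :
    LinearMap.range (LinearMap.lsmul ℤ (Additive (𝓞 K)ˣ) ℓ) ≤
      (LinearMap.range (LinearMap.lsmul ℤ (Additive (𝓞 K)ˣ) ℓ)).comap
        (MonoidHom.toAdditive (unitAction σ)).toIntLinearMap := by
  rintro _ ⟨u, rfl⟩
  exact ⟨(MonoidHom.toAdditive (unitAction σ)).toIntLinearMap u, by simp⟩

/-- The `𝔽_ℓ`-linear endomorphism of `U / U^ℓ` induced by `σ`. -/
def actionMod (σ : K ≃ₐ[ℚ] K) (ℓ : ℕ) : Module.End (ZMod ℓ) (UnitsMod K ℓ) :=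
  AddMonoidHom.toZModLinearMap ℓ
    (Submodule.mapQ _ _ (MonoidHom.toAdditive (unitAction σ)).toIntLinearMap
      (range_le_comap σ ℓ)).toAddMonoidHom

theorem actionMod_unitClass (σ : K ≃ₐ[ℚ] K) (ℓ : ℕ) (u : (𝓞 K)ˣ) :
    actionMod σ ℓ (unitClass ℓ u) = unitClass ℓ (unitAction σ u) := rfl

/-- The eigenspace `E_c` of `σ` acting on `U / U^ℓ`. -/
def unitEigenspace (σ : K ≃ₐ[ℚ] K) (ℓ : ℕ) (c : ZMod ℓ) :
    Submodule (ZMod ℓ) (UnitsMod K ℓ) :=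
  Module.End.eigenspace (actionMod σ ℓ) c

/-- The number `𝓡`: the number of elements outside `E_A` in a basis of `U / U^ℓ` made of
eigenvectors of `σ`, that is, the dimension of the sum of the eigenspaces `E_c`, `c ≠ A`. -/
def numVanishing (σ : K ≃ₐ[ℚ] K) (ℓ : ℕ) (A : ZMod ℓ) : ℕ :=
  Module.finrank (ZMod ℓ) (⨆ c : {c : ZMod ℓ // c ≠ A}, unitEigenspace σ ℓ c : Submodule _ _)

/-- Units whose classes form a basis of `U / U^ℓ` over `𝔽_ℓ`. -/
def IsBasisMod (ℓ : ℕ) {ι : Type*} (u : ι → (𝓞 K)ˣ) : Prop :=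
  LinearIndependent (ZMod ℓ) (fun i => unitClass ℓ (u i)) ∧
    Submodule.span (ZMod ℓ) (Set.range fun i => unitClass ℓ (u i)) = ⊤

end Fields

/-- The signature of a number field: the numbers of its real places and of its complex places. -/
def signature (F : Type*) [Field F] [NumberField F] : ℕ × ℕ :=
  (InfinitePlace.nrRealPlaces F, InfinitePlace.nrComplexPlaces F)

/-- The discrete logarithm of `x` in base `g`: the least `k` with `g ^ k = x`
(and `0` if `x` is not a power of `g`). -/
def discreteLog {M : Type*} [Monoid M] (g x : M) : ℕ := sInf {k : ℕ | g ^ k = x}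

/-- `logRho 𝔭 g ℓ x` is `log ρ(x)` modulo `ℓ`, where `ρ` is the reduction modulo `𝔭` and
`log` is the discrete logarithm in base `g` in the residue field. -/
def logRho {K : Type*} [Field K] [NumberField K] (𝔭 : Ideal (𝓞 K)) (g : 𝓞 K ⧸ 𝔭) (ℓ : ℕ)
    (x : 𝓞 K) : ZMod ℓ :=
  (discreteLog g (Ideal.Quotient.mk 𝔭 x) : ZMod ℓ)

/-- `A` satisfies `log ρ(σ(x)) ≡ A log ρ(x) mod ℓ` for all `x` of norm coprime to `p`. -/
def LogCompatible {K : Type*} [Field K] [NumberField K] (σ : K ≃ₐ[ℚ] K) (p : ℕ)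
    (𝔭 : Ideal (𝓞 K)) (g : 𝓞 K ⧸ 𝔭) (ℓ : ℕ) (A : ℤ) : Prop :=
  ∀ x : 𝓞 K, IsCoprime (Algebra.norm ℤ x) (p : ℤ) →
    logRho 𝔭 g ℓ (intAction σ x) = (A : ZMod ℓ) * logRho 𝔭 g ℓ x

/-- A line of the table: the degree of `K`, the order of `σ`, the signatures of `K` and of the
field fixed by `σ`, the minimal polynomial of `σ` on the units, the value of `𝓡`, the unit
rank `r` and the difference `r - 𝓡`. -/
structure Row where
  deg : ℕ
  ord : ℕ
  sign : ℕ × ℕ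
  signFixed : ℕ × ℕ
  mu : ℤ[X]
  numVanish : ℕ
  rank : ℕ
  corank : ℕ

/-- The table. When `σ` generates a group of order `[K : ℚ]` the fixed field is `ℚ`, which has
signature `(1, 0)`. -/
def table : List Row :=
  [⟨4, 2, (4, 0), (2, 0), (X - 1) * (X + 1), 1, 3, 2⟩,
   ⟨4, 2, (2, 1), (2, 0), (X - 1) * (X + 1), 1, 2, 1⟩,
   ⟨4, 2, (0, 2), (0, 1), X + 1, 0, 1, 1⟩,
   ⟨4, 2, (0, 2), (2, 0), X - 1, 1, 1, 0⟩,
   ⟨4, 4, (4, 0), (1, 0), (X + 1) * (X ^ 2 + 1), 2, 3, 1⟩,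
   ⟨4, 4, (0, 2), (1, 0), X + 1, 1, 1, 0⟩,
   ⟨6, 2, (0, 3), (1, 1), (X - 1) * (X + 1), 1, 2, 1⟩,
   ⟨6, 2, (0, 3), (3, 0), X - 1, 2, 2, 0⟩,
   ⟨6, 3, (6, 0), (2, 0), (X - 1) * (X ^ 2 + X + 1), 3, 5, 2⟩,
   ⟨6, 3, (0, 3), (0, 1), X ^ 2 + X + 1, 1, 2, 1⟩,
   ⟨6, 6, (6, 0), (1, 0), (X + 1) * (X ^ 2 + X + 1) * (X ^ 2 - X + 1), 4, 5, 1⟩,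
   ⟨6, 6, (0, 3), (1, 0), X ^ 2 + X + 1, 2, 2, 0⟩]

/-- The line `row` is the one that corresponds to `K` and `σ`. -/
def Row.Matches (row : Row) {K : Type*} [Field K] [NumberField K] (σ : K ≃ₐ[ℚ] K) : Prop :=
  Module.finrank ℚ K = row.deg ∧ orderOf σ = row.ord ∧ signature K = row.sign ∧
    signature (IntermediateField.fixedField (Subgroup.zpowers σ)) = row.signFixed

end NFSUnits

end

noncomputable section

namespace NFSUnits

/-! ### Integral endomorphisms of finite order and their reductions -/

section LinearAlgebra

/-! Let `m = orderOf σ` and let `T` be the action of `σ` on the lattice `U / U_tor`. As `T ^ m = 1`,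
its characteristic polynomial is a product of cyclotomic polynomials `Φ_d ^ a d` with `d ∣ m`, and
since `T` is semisimple over `ℚ`, its minimal polynomial is the product of the `Φ_d` with `a d ≠ 0`.
Everything therefore reduces to the exponents `a d`. For `k ∣ m` the sum of `a d * φ(d)` over `d ∣
k` is the rank of `ker (T ^ k - 1)`, which is the unit rank of the field fixed by `σ ^ k`
(`finrank_ker_pow_sub_one`, `finrank_ker_actionModTorsion_sub_one`). So signatures of subfields
determine the exponents.

Modulo `ℓ`: without roots of unity of order `ℓ`, `U / U^ℓ` is the reduction of `U / U_tor`, so the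
characteristic polynomial reduces too. Since `ℓ ∤ m`, algebraic and geometric multiplicities agree,
and a primitive `m`-th root of unity `A` in `𝔽_ℓ` has eigenspace of dimension `a m`; its existence
also makes `σ` diagonalizable, whence `𝓡 = r - a m`.

`A` is indeed a primitive `m`-th root of unity. Always `A ^ m = 1`, which with `A ≠ 1` suffices for
`m` prime. If `m = [K : ℚ]`, the Frobenius at `𝔭` is some `σ ^ i`, so `A ^ i = p` in `𝔽_ℓ`, and `p`
has order `n = m` there because `ℓ ∣ Φ_n(p)`. Finally, if `σ(u) = u ^ c * v ^ ℓ`, then `A log u = c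
log u`, so `log u = 0` when `c ≠ A`. -/

theorem dvd_aeval_sub_aeval_of_commute {R S : Type*} [CommRing R] [Ring S] [Algebra R S]
    {a b : S} (h : Commute a b) (p : R[X]) : a - b ∣ aeval a p - aeval b p := by
  induction p using Polynomial.induction_on' with
  | add p q hp hq =>
    have : aeval a (p + q) - aeval b (p + q)
        = (aeval a p - aeval b p) + (aeval a q - aeval b q) := by
      simp only [map_add]; abel
    exact this ▸ dvd_add hp hq
  | monomial n r =>
    obtain ⟨c, hc⟩ := h.sub_dvd_pow_sub_pow n
    refine ⟨algebraMap R S r * c, ?_⟩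
    rw [aeval_monomial, aeval_monomial, ← mul_sub, hc, ← mul_assoc, ← mul_assoc,
      Algebra.commutes]

/-- Over `R[X]`, `X - A` divides `p(X) - p(A) = p(X) • 1`; take determinants. The argument needs no
field, so it applies over `ℤ`. -/
theorem charpoly_dvd_pow_of_aeval_matrix_eq_zero {R n : Type*} [CommRing R] [Fintype n]
    [DecidableEq n] (A : Matrix n n R) {p : R[X]} (h : aeval A p = 0) :
    A.charpoly ∣ p ^ Fintype.card n := by
  let s : Matrix n n R[X] := algebraMap R[X] _ X
  let B : Matrix n n R[X] := (CAlgHom (R := R) (A := R)).mapMatrix A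
  have hB : aeval B p = 0 := by
    rw [aeval_algHom_apply, h, map_zero]
  have hs : aeval s p = algebraMap R[X] (Matrix n n R[X]) p := by
    rw [aeval_algebraMap_apply, aeval_X_left_apply]
  have hc : Commute s B := Algebra.commutes _ _
  obtain ⟨Q, hQ⟩ := dvd_aeval_sub_aeval_of_commute hc p
  rw [hB, hs, sub_zero] at hQ
  have := congrArg Matrix.det hQ
  rw [Matrix.det_mul, Matrix.algebraMap_eq_diagonal] at this
  refine ⟨Q.det, ?_⟩
  have hdet : A.charpoly = (s - B).det := by
    rw [Matrix.charpoly, Matrix.charmatrix]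
    rfl
  rw [hdet]
  simpa [Matrix.det_diagonal] using this

theorem charpoly_dvd_pow_of_aeval_eq_zero {R M : Type*} [CommRing R] [Nontrivial R]
    [AddCommGroup M] [Module R M] [Module.Free R M] [Module.Finite R M] (T : Module.End R M)
    {p : R[X]} (h : aeval T p = 0) : T.charpoly ∣ p ^ Module.finrank R M := by
  classical
  let b := Module.Free.chooseBasis R M
  have := charpoly_dvd_pow_of_aeval_matrix_eq_zero (LinearMap.toMatrixAlgEquiv b T) (p := p)
    (by rw [aeval_algHom_apply, h, map_zero])
  rwa [Module.finrank_eq_card_chooseBasisIndex, ← LinearMap.charpoly_toMatrix T b]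

theorem associated_prod_pow_of_dvd {R ι : Type*} [CommRing R] [IsDomain R]
    [UniqueFactorizationMonoid R] (s : Finset ι) (q : ι → R) (hq : ∀ i ∈ s, Prime (q i))
    (N : ℕ) (x : R) (hx : x ∣ ∏ i ∈ s, q i ^ N) :
    ∃ a : ι → ℕ, Associated x (∏ i ∈ s, q i ^ a i) := by
  classical
  induction s using Finset.induction_on generalizing x with
  | empty => exact ⟨0, by simpa using isUnit_of_dvd_one (by simpa using hx)⟩
  | insert i s hi ih =>
    rw [Finset.prod_insert hi] at hx
    obtain ⟨y, z, hy, hz, rfl⟩ := exists_dvd_and_dvd_of_dvd_mul hx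
    obtain ⟨k, -, hk⟩ := (dvd_prime_pow (hq i (Finset.mem_insert_self _ _)) N).1 hy
    obtain ⟨a, ha⟩ := ih (fun j hj => hq j (Finset.mem_insert_of_mem hj)) z hz
    refine ⟨Function.update a i k, ?_⟩
    rw [Finset.prod_insert hi, Function.update_self]
    refine hk.mul_mul (ha.trans (Associated.of_eq (Finset.prod_congr rfl fun j hj => ?_)))
    rw [Function.update_of_ne (ne_of_mem_of_not_mem hj hi)]

variable {M : Type*} [AddCommGroup M] [Module.Free ℤ M] [Module.Finite ℤ M]

/-- The characteristic polynomial divides a power of `X ^ m - 1`, whose prime factors in `ℤ[X]` are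
the `Φ_d`; monicity turns association into equality. -/
theorem charpoly_eq_prod_cyclotomic (T : Module.End ℤ M) {m : ℕ} (hm : 0 < m) (hT : T ^ m = 1) :
    ∃ a : ℕ → ℕ, T.charpoly = ∏ d ∈ m.divisors, cyclotomic d ℤ ^ a d := by
  have h : aeval T (X ^ m - 1 : ℤ[X]) = 0 := by simp [hT]
  have hd := charpoly_dvd_pow_of_aeval_eq_zero T h
  rw [← prod_cyclotomic_eq_X_pow_sub_one hm, ← Finset.prod_pow] at hd
  obtain ⟨a, ha⟩ := associated_prod_pow_of_dvd _ _
    (fun d hd => (cyclotomic.irreducible (Nat.pos_of_mem_divisors hd)).prime) _ _ hd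
  exact ⟨a, eq_of_monic_of_associated T.charpoly_monic
    (monic_prod_of_monic _ _ fun d _ => (cyclotomic.monic d ℤ).pow _) ha⟩

theorem finrank_eq_sum_of_charpoly (T : Module.End ℤ M) {m : ℕ} {a : ℕ → ℕ}
    (ha : T.charpoly = ∏ d ∈ m.divisors, cyclotomic d ℤ ^ a d) :
    Module.finrank ℤ M = ∑ d ∈ m.divisors, a d * d.totient := by
  rw [← T.charpoly_natDegree, ha, natDegree_prod_of_monic _ _
    fun d _ => (cyclotomic.monic d ℤ).pow _]
  exact Finset.sum_congr rfl fun d _ => by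
    rw [(cyclotomic.monic d ℤ).natDegree_pow, natDegree_cyclotomic]

/-- When `m` is invertible in `F`, each `Φ_d` with `d ∣ m` is separable over `F` and its roots are
exactly the primitive `d`-th roots of unity, so `c` is a simple root of `Φ_e` and of no other
factor. -/
theorem rootMultiplicity_prod_cyclotomic {F : Type*} [Field F] {m e : ℕ} (hm : (m : F) ≠ 0)
    (he : e ∣ m) {c : F} (hc : IsPrimitiveRoot c e) (a : ℕ → ℕ) :
    ((∏ d ∈ m.divisors, cyclotomic d ℤ ^ a d).map (Int.castRingHom F)).rootMultiplicity c
      = a e := by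
  classical
  have hm0 : m ≠ 0 := by rintro rfl; simp at hm
  have hne : ∀ d ∈ m.divisors, cyclotomic d F ^ a d ≠ 0 := fun d _ =>
    pow_ne_zero _ (cyclotomic_ne_zero d F)
  rw [Polynomial.map_prod]
  simp only [Polynomial.map_pow, map_cyclotomic]
  rw [← count_roots, roots_prod _ _ (Finset.prod_ne_zero_iff.2 hne), Multiset.count_bind]
  simp only [roots_pow, Multiset.count_nsmul, count_roots]
  change ∑ d ∈ m.divisors, a d * rootMultiplicity c (cyclotomic d F) = a e
  have key : ∀ d ∈ m.divisors,
      rootMultiplicity c (cyclotomic d F) = if d = e then 1 else 0 := by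
    intro d hd
    have hdF : NeZero (d : F) := ⟨fun h0 => hm (by
      obtain ⟨k, rfl⟩ := Nat.dvd_of_mem_divisors hd
      simp [h0])⟩
    have hroot : (cyclotomic d F).IsRoot c ↔ d = e := by
      rw [isRoot_cyclotomic_iff]
      exact ⟨fun h => h.unique hc, fun h => h ▸ hc⟩
    split_ifs with h
    · refine le_antisymm (rootMultiplicity_le_one_of_separable
        (separable_cyclotomic d F) c) ?_
      exact (rootMultiplicity_pos (cyclotomic_ne_zero d F)).2 (hroot.2 h)
    · exact rootMultiplicity_eq_zero fun h' => h (hroot.1 h')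
  rw [Finset.sum_congr rfl fun d hd => by rw [key d hd]]
  simp [he, hm0]

theorem isSemisimple_of_pow_eq_one {F V : Type*} [Field F] [AddCommGroup V] [Module F V]
    (f : Module.End F V) {m : ℕ} (hm : (m : F) ≠ 0) (hf : f ^ m = 1) : f.IsSemisimple :=
  Module.End.isSemisimple_of_squarefree_aeval_eq_zero (p := X ^ m - 1)
    (separable_X_pow_sub_C (1 : F) hm one_ne_zero).squarefree (by simp [hf])

theorem finrank_eigenspace_eq_rootMultiplicity {F V : Type*} [Field F] [AddCommGroup V]
    [Module F V] [FiniteDimensional F V] (f : Module.End F V) {m : ℕ} (hm : (m : F) ≠ 0)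
    (hf : f ^ m = 1) (c : F) :
    Module.finrank F (f.eigenspace c) = f.charpoly.rootMultiplicity c := by
  rw [← LinearMap.finrank_maxGenEigenspace_eq,
    (isSemisimple_of_pow_eq_one f hm hf).isFinitelySemisimple.maxGenEigenspace_eq_eigenspace]

theorem eigenspace_eq_ker_aeval {F V : Type*} [Field F] [AddCommGroup V] [Module F V]
    (f : Module.End F V) (c : F) : f.eigenspace c = LinearMap.ker (aeval f (X - C c)) := by
  rw [Module.End.eigenspace_def]
  simp [Algebra.algebraMap_eq_smul_one]

theorem X_sub_C_isCoprime_prod {F : Type*} [Field F] {c : F} {s : Finset F} (hc : c ∉ s) :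
    IsCoprime (X - C c) (∏ c ∈ s, (X - C c)) :=
  IsCoprime.prod_right fun _ hd =>
    isCoprime_X_sub_C_of_isUnit_sub (sub_ne_zero.2 (ne_of_mem_of_not_mem hd hc).symm).isUnit

theorem finrank_ker_aeval_prod_X_sub_C {F V : Type*} [Field F] [AddCommGroup V]
    [Module F V] [FiniteDimensional F V] (f : Module.End F V) (s : Finset F) :
    Module.finrank F (LinearMap.ker (aeval f (∏ c ∈ s, (X - C c)))) =
      ∑ c ∈ s, Module.finrank F (f.eigenspace c) := by
  classical
  induction s using Finset.induction_on with
  | empty =>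
    have : LinearMap.ker (1 : Module.End F V) = ⊥ := LinearMap.ker_id
    rw [Finset.prod_empty, map_one, this, finrank_bot, Finset.sum_empty]
  | insert c s hc ih =>
    have hco := X_sub_C_isCoprime_prod hc
    have h1 := Submodule.finrank_sup_add_finrank_inf_eq
      (LinearMap.ker (aeval f (X - C c))) (LinearMap.ker (aeval f (∏ c ∈ s, (X - C c))))
    rw [(disjoint_ker_aeval_of_isCoprime f hco).eq_bot, finrank_bot, add_zero] at h1
    rw [Finset.prod_insert hc, Finset.sum_insert hc, ← ih,
      ← sup_ker_aeval_eq_ker_aeval_mul_of_coprime f hco, h1, eigenspace_eq_ker_aeval]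

theorem ker_aeval_prod_X_sub_C_le {F V : Type*} [Field F] [AddCommGroup V] [Module F V]
    (f : Module.End F V) (s : Finset F) :
    LinearMap.ker (aeval f (∏ c ∈ s, (X - C c))) ≤ ⨆ c, f.eigenspace c := by
  classical
  induction s using Finset.induction_on with
  | empty =>
    have : LinearMap.ker (1 : Module.End F V) = ⊥ := LinearMap.ker_id
    rw [Finset.prod_empty, map_one, this]
    exact bot_le
  | insert c s hc ih =>
    rw [Finset.prod_insert hc, ← sup_ker_aeval_eq_ker_aeval_mul_of_coprime f
      (X_sub_C_isCoprime_prod hc), ← eigenspace_eq_ker_aeval]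
    exact sup_le (le_iSup f.eigenspace c) ih

/-- A primitive `m`-th root of unity splits `X ^ m - 1`, which kills `f`, into distinct linear
factors. -/
theorem iSup_eigenspace_eq_top {F V : Type*} [Field F] [AddCommGroup V] [Module F V]
    (f : Module.End F V) {m : ℕ} (hm : 0 < m) (hf : f ^ m = 1) {ζ : F}
    (hζ : IsPrimitiveRoot ζ m) : ⨆ c, f.eigenspace c = ⊤ := by
  classical
  refine top_le_iff.1 (le_trans ?_ (ker_aeval_prod_X_sub_C_le f (nthRootsFinset m (1 : F))))
  rw [← X_pow_sub_one_eq_prod hm hζ]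
  simp [hf]

theorem isCompl_eigenspace {F V : Type*} [Field F] [AddCommGroup V] [Module F V]
    (f : Module.End F V) {m : ℕ} (hm : 0 < m) (hf : f ^ m = 1) {ζ : F}
    (hζ : IsPrimitiveRoot ζ m) (A : F) :
    IsCompl (⨆ c : {c : F // c ≠ A}, f.eigenspace c) (f.eigenspace A) := by
  rw [iSup_subtype]
  refine ⟨(f.eigenspaces_iSupIndep A).symm, codisjoint_iff.2 (top_le_iff.1 ?_)⟩
  rw [← iSup_eigenspace_eq_top f hm hf hζ]
  refine iSup_le fun c => ?_
  by_cases h : c = A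
  · exact h ▸ le_sup_right
  · exact le_sup_of_le_left (le_iSup₂_of_le c h le_rfl)

theorem finrank_ker_baseChange {M : Type*} [AddCommGroup M] [Module.Free ℤ M]
    [Module.Finite ℤ M] (A : Type*) [Field A] [CharZero A] (T : Module.End ℤ M) :
    Module.finrank A (LinearMap.ker (T.baseChange A)) = Module.finrank ℤ (LinearMap.ker T) := by
  have : Module.Flat ℤ A := inferInstance
  rw [← Module.finrank_baseChange (R := A) (M' := LinearMap.ker T)]
  exact (LinearMap.tensorKerEquiv A A T).finrank_eq.symm

/-- By flatness the rank may be computed over `ℂ`, where the kernel is the sum of the eigenspaces of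
the `k`-th roots of unity. The `φ(d)` primitive `d`-th roots contribute `a d` each. -/
theorem finrank_ker_pow_sub_one (T : Module.End ℤ M) {m k : ℕ} (hm : 0 < m) (hT : T ^ m = 1)
    (hk : k ∣ m) {a : ℕ → ℕ} (ha : T.charpoly = ∏ d ∈ m.divisors, cyclotomic d ℤ ^ a d) :
    Module.finrank ℤ (LinearMap.ker (T ^ k - 1)) = ∑ d ∈ k.divisors, a d * d.totient := by
  classical
  have hk0 : 0 < k := Nat.pos_of_dvd_of_pos hk hm
  have hmC : (m : ℂ) ≠ 0 := Nat.cast_ne_zero.2 hm.ne'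
  have hζ := Complex.isPrimitiveRoot_exp k hk0.ne'
  let f : Module.End ℂ _ := Module.End.baseChangeHom ℤ ℂ M T
  have hf : f ^ m = 1 := by rw [← map_pow, hT, map_one]
  have hfk : (T ^ k - 1).baseChange ℂ = aeval f (∏ c ∈ nthRootsFinset k (1 : ℂ), (X - C c)) := by
    rw [← X_pow_sub_one_eq_prod hk0 hζ]
    change Module.End.baseChangeHom ℤ ℂ M (T ^ k - 1) = _
    simp [f]
  rw [← finrank_ker_baseChange ℂ, hfk, finrank_ker_aeval_prod_X_sub_C,
    IsPrimitiveRoot.nthRoots_one_eq_biUnion_primitiveRoots, Finset.sum_biUnion]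
  · refine Finset.sum_congr rfl fun d hd => ?_
    rw [Finset.sum_congr rfl (g := fun _ => a d), Finset.sum_const, Complex.card_primitiveRoots,
      smul_eq_mul, mul_comm]
    intro c hc
    rw [finrank_eigenspace_eq_rootMultiplicity f hmC hf]
    change (T.baseChange ℂ).charpoly.rootMultiplicity c = _
    rw [LinearMap.charpoly_baseChange, ha]
    exact rootMultiplicity_prod_cyclotomic hmC ((Nat.dvd_of_mem_divisors hd).trans hk)
      ((mem_primitiveRoots (Nat.pos_of_mem_divisors hd)).1 hc) a
  · exact fun d _ e _ hde => IsPrimitiveRoot.disjoint hde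

theorem eq_zero_of_baseChange_eq_zero (A : Type*) [Field A] [CharZero A] (T : Module.End ℤ M)
    (h : T.baseChange A = 0) : T = 0 := by
  classical
  let b := Module.Free.chooseBasis ℤ M
  refine (LinearMap.toMatrix b b).injective ?_
  ext i j
  have := congrArg (fun S => LinearMap.toMatrix (Algebra.TensorProduct.basis A b)
    (Algebra.TensorProduct.basis A b) S i j) h
  rw [LinearMap.toMatrix_baseChange, map_zero, Matrix.map_apply] at this
  simpa using this

theorem minpoly_eq_prod_cyclotomic (T : Module.End ℤ M) {m : ℕ} (hm : 0 < m) (hT : T ^ m = 1)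
    {a : ℕ → ℕ} (ha : T.charpoly = ∏ d ∈ m.divisors, cyclotomic d ℤ ^ a d) :
    minpoly ℤ T = ∏ d ∈ m.divisors with a d ≠ 0, cyclotomic d ℤ := by
  classical
  have hpos : ∀ d ∈ m.divisors, 0 < d := fun d hd => Nat.pos_of_mem_divisors hd
  symm
  refine minpoly.unique' ℤ T (monic_prod_of_monic _ _ fun d _ => cyclotomic.monic d ℤ) ?_ ?_
  -- Here `f * g = X ^ m - 1`, and `g` collects the factors missing from the characteristic
  -- polynomial, so a Bézout relation over `ℚ` makes `g(T)` invertible. Then `f(T) g(T) = 0` gives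
  -- `f(T) = 0` over `ℚ`, hence over `ℤ` because the module is free.
  · set f := ∏ d ∈ m.divisors with a d ≠ 0, cyclotomic d ℤ
    set g := ∏ d ∈ m.divisors with ¬ a d ≠ 0, cyclotomic d ℤ with hg
    have hfg : f * g = X ^ m - 1 := by
      rw [← prod_cyclotomic_eq_X_pow_sub_one hm]
      exact Finset.prod_filter_mul_prod_filter_not _ _ _
    have hco : IsCoprime (T.charpoly.map (algebraMap ℤ ℚ)) (g.map (algebraMap ℤ ℚ)) := by
      rw [ha, hg, Polynomial.map_prod, Polynomial.map_prod]
      refine IsCoprime.prod_left fun d hd => IsCoprime.prod_right fun e he => ?_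
      rw [Polynomial.map_pow, map_cyclotomic, map_cyclotomic]
      rw [Finset.mem_filter, not_not] at he
      by_cases hde : d = e
      · rw [hde, he.2, pow_zero]
        exact isCoprime_one_left
      · exact (cyclotomic.isCoprime_rat hde).pow_left
    obtain ⟨u, v, huv⟩ := hco
    let S : Module.End ℚ _ := Module.End.baseChangeHom ℤ ℚ M T
    have hS : ∀ q : ℤ[X], aeval S (q.map (algebraMap ℤ ℚ)) = (aeval T q).baseChange ℚ := by
      intro q
      rw [aeval_map_algebraMap]
      exact aeval_algHom_apply (Module.End.baseChangeHom ℤ ℚ M) T q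
    refine eq_zero_of_baseChange_eq_zero ℚ _ ?_
    have h1 := congrArg (aeval S) huv
    have h2 : aeval S (f.map (algebraMap ℤ ℚ) * g.map (algebraMap ℤ ℚ)) = 0 := by
      rw [← Polynomial.map_mul, hS, hfg]
      simp [hT]
    rw [map_add, map_mul, map_mul, hS, LinearMap.aeval_self_charpoly, LinearMap.baseChange_zero,
      mul_zero, zero_add, map_one] at h1
    rw [← hS, ← mul_one (aeval S (f.map _)), ← h1, ← map_mul, ← map_mul, mul_left_comm, map_mul,
      h2, mul_zero]
  · intro q hq
    by_contra! hcon
    obtain ⟨hq0, hTq⟩ := hcon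
    -- The characteristic polynomial divides a power of any `q` with `q(T) = 0`, so each `Φ_d` that
    -- occurs divides `q`.
    have hdvd : ∏ d ∈ m.divisors with a d ≠ 0, cyclotomic d ℤ ∣ q := by
      refine Finset.prod_dvd_of_isRelPrime ?_ ?_
      · intro d hd e he hde
        rw [Finset.mem_coe, Finset.mem_filter] at hd he
        change IsRelPrime (cyclotomic d ℤ) (cyclotomic e ℤ)
        rw [(cyclotomic.irreducible (hpos d hd.1)).isRelPrime_iff_not_dvd]
        intro h
        refine hde (cyclotomic_injective (R := ℤ) ?_)
        exact eq_of_monic_of_associated (cyclotomic.monic d ℤ) (cyclotomic.monic e ℤ)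
          ((cyclotomic.irreducible (hpos d hd.1)).associated_of_dvd
            (cyclotomic.irreducible (hpos e he.1)) h)
      · intro d hd
        rw [Finset.mem_filter] at hd
        refine (cyclotomic.irreducible (hpos d hd.1)).prime.dvd_of_dvd_pow
          (dvd_trans ?_ (charpoly_dvd_pow_of_aeval_eq_zero T hTq))
        rw [ha]
        exact (dvd_pow_self _ hd.2).trans (Finset.dvd_prod_of_mem _ hd.1)
    exact absurd (degree_le_of_dvd hdvd hq0) (not_le.2 hq)

end LinearAlgebra

/-! ### The action on units modulo torsion and the units of fixed fields -/

section Units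

variable {K : Type*} [Field K] [NumberField K]

theorem coe_intAction (σ : K ≃ₐ[ℚ] K) (x : 𝓞 K) : ((intAction σ x : 𝓞 K) : K) = σ x := rfl

theorem coe_unitAction (σ : K ≃ₐ[ℚ] K) (u : (𝓞 K)ˣ) :
    ((unitAction σ u : (𝓞 K)ˣ) : 𝓞 K) = intAction σ u := rfl

theorem unitAction_mul (σ τ : K ≃ₐ[ℚ] K) (u : (𝓞 K)ˣ) :
    unitAction (σ * τ) u = unitAction σ (unitAction τ u) :=
  Units.ext (RingOfIntegers.ext rfl)

theorem unitAction_one (u : (𝓞 K)ˣ) : unitAction (1 : K ≃ₐ[ℚ] K) u = u :=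
  Units.ext (RingOfIntegers.ext rfl)

theorem actionModTorsion_mk (σ : K ≃ₐ[ℚ] K) (u : (𝓞 K)ˣ) :
    actionModTorsion σ (Additive.ofMul (QuotientGroup.mk u)) =
      Additive.ofMul (QuotientGroup.mk (unitAction σ u)) := rfl

theorem exists_ofMul_mk_eq (x : UnitsModTorsion K) :
    ∃ u : (𝓞 K)ˣ, Additive.ofMul (QuotientGroup.mk u) = x :=
  QuotientGroup.mk_surjective x.toMul

theorem actionModTorsion_one : actionModTorsion (1 : K ≃ₐ[ℚ] K) = 1 := by
  ext x
  obtain ⟨u, rfl⟩ := exists_ofMul_mk_eq x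
  rw [actionModTorsion_mk, unitAction_one, Module.End.one_apply]

theorem actionModTorsion_mul (σ τ : K ≃ₐ[ℚ] K) :
    actionModTorsion (σ * τ) = actionModTorsion σ * actionModTorsion τ := by
  ext x
  obtain ⟨u, rfl⟩ := exists_ofMul_mk_eq x
  rw [Module.End.mul_apply, actionModTorsion_mk, actionModTorsion_mk, actionModTorsion_mk,
    unitAction_mul]

theorem actionModTorsion_pow (σ : K ≃ₐ[ℚ] K) (k : ℕ) :
    actionModTorsion (σ ^ k) = actionModTorsion σ ^ k := by
  induction k with
  | zero => rw [pow_zero, pow_zero, actionModTorsion_one]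
  | succ k ih => rw [pow_succ, pow_succ, actionModTorsion_mul, ih]

theorem actionModTorsion_pow_orderOf (σ : K ≃ₐ[ℚ] K) : actionModTorsion σ ^ orderOf σ = 1 := by
  rw [← actionModTorsion_pow, pow_orderOf_eq_one, actionModTorsion_one]

section Subfield

variable (F : IntermediateField ℚ K)

theorem torsion_le_comap_units_map :
    Units.torsion F ≤ (Units.torsion K).comap (Units.map (algebraMap (𝓞 F) (𝓞 K)).toMonoidHom) :=
  fun _ hu => MonoidHom.isOfFinOrder _ hu

/-- The inclusion of the units of a subfield, modulo torsion. -/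
def subfieldUnits : UnitsModTorsion F →ₗ[ℤ] UnitsModTorsion K :=
  (MonoidHom.toAdditive (QuotientGroup.map (Units.torsion F) (Units.torsion K)
    (Units.map (algebraMap (𝓞 F) (𝓞 K)).toMonoidHom)
      (torsion_le_comap_units_map F))).toIntLinearMap

theorem subfieldUnits_mk (u : (𝓞 F)ˣ) :
    subfieldUnits F (Additive.ofMul (QuotientGroup.mk u)) =
      Additive.ofMul (QuotientGroup.mk (Units.map (algebraMap (𝓞 F) (𝓞 K)).toMonoidHom u)) := rfl

theorem ofMul_mk_eq_zero (u : (𝓞 K)ˣ) :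
    (Additive.ofMul (QuotientGroup.mk u) : UnitsModTorsion K) = 0 ↔ u ∈ Units.torsion K :=
  QuotientGroup.eq_one_iff u

theorem subfieldUnits_injective : Function.Injective (subfieldUnits F) := by
  rw [injective_iff_map_eq_zero]
  intro x hu
  obtain ⟨u, rfl⟩ := exists_ofMul_mk_eq x
  rw [subfieldUnits_mk, ofMul_mk_eq_zero] at hu
  rw [ofMul_mk_eq_zero]
  refine (Function.Injective.isOfFinOrder_iff ?_).1 hu
  exact Units.map_injective (FaithfulSMul.algebraMap_injective (𝓞 F) (𝓞 K))

end Subfield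

theorem exists_unit_of_fixed (τ : K ≃ₐ[ℚ] K) (u : (𝓞 K)ˣ) (hu : unitAction τ u = u) :
    ∃ v : (𝓞 (IntermediateField.fixedField (Subgroup.zpowers τ)))ˣ,
      Units.map (algebraMap (𝓞 (IntermediateField.fixedField (Subgroup.zpowers τ)))
        (𝓞 K)).toMonoidHom v = u := by
  set F := IntermediateField.fixedField (Subgroup.zpowers τ)
  have key : ∀ w : (𝓞 K)ˣ, unitAction τ w = w → ∃ y : 𝓞 F, algebraMap (𝓞 F) (𝓞 K) y = w := by
    intro w hw
    have hτ : τ ((w : 𝓞 K) : K) = ((w : 𝓞 K) : K) := by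
      rw [← coe_intAction, ← coe_unitAction, hw]
    have hF : ((w : 𝓞 K) : K) ∈ F := by
      rintro ⟨g, hg⟩
      have : Subgroup.zpowers τ ≤ MulAction.stabilizer (K ≃ₐ[ℚ] K) ((w : 𝓞 K) : K) :=
        (Subgroup.zpowers_le).2 hτ
      exact this hg
    have hint : IsIntegral ℤ (⟨_, hF⟩ : F) :=
      (isIntegral_algebraMap_iff (algebraMap F K).injective).1
        (RingOfIntegers.isIntegral_coe (w : 𝓞 K))
    exact ⟨⟨⟨_, hF⟩, hint⟩, RingOfIntegers.ext rfl⟩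
  obtain ⟨y, hy⟩ := key u hu
  -- The inverse must be descended as well, to obtain a unit of the subfield and not only an
  -- integer.
  obtain ⟨z, hz⟩ := key u⁻¹ (by rw [map_inv, hu])
  have hinj := FaithfulSMul.algebraMap_injective (𝓞 F) (𝓞 K)
  have hyz : y * z = 1 := hinj (by rw [map_mul, hy, hz, map_one, Units.mul_inv])
  exact ⟨⟨y, z, hyz, by rw [mul_comm, hyz]⟩, Units.ext hy⟩

theorem finrank_ker_actionModTorsion_sub_one (τ : K ≃ₐ[ℚ] K) :
    Module.finrank ℤ (LinearMap.ker (actionModTorsion τ - 1)) =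
      Units.rank (IntermediateField.fixedField (Subgroup.zpowers τ)) := by
  set F := IntermediateField.fixedField (Subgroup.zpowers τ) with hFdef
  rw [← Units.finrank_modTorsion, ← LinearMap.finrank_range_of_inj (subfieldUnits_injective F)]
  refine le_antisymm ?_ (Submodule.finrank_mono ?_)
  -- A class fixed by `τ` only says that `τ(u) / u` is torsion. Its `N`-th power is `1`, so `u ^ N`
  -- is truly fixed, and multiplication by `N` is injective on the torsion-free quotient, so no rank
  -- is lost.
  · let N : ℤ := Units.torsionOrder K
    have hN : N ≠ 0 := Nat.cast_ne_zero.2 (Units.torsionOrder_ne_zero K)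
    let f : LinearMap.ker (actionModTorsion τ - 1) →ₗ[ℤ] UnitsModTorsion K :=
      N • (LinearMap.ker (actionModTorsion τ - 1)).subtype
    have hf : ∀ x, f x ∈ LinearMap.range (subfieldUnits F) := by
      rintro ⟨x, hu⟩
      obtain ⟨u, rfl⟩ := exists_ofMul_mk_eq x
      rw [LinearMap.mem_ker, LinearMap.sub_apply, actionModTorsion_mk, Module.End.one_apply,
        ← ofMul_div, ← QuotientGroup.mk_div, ofMul_mk_eq_zero,
        ← Units.rootsOfUnity_eq_torsion, mem_rootsOfUnity, div_pow, div_eq_one, ← map_pow] at hu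
      obtain ⟨v, hv⟩ := exists_unit_of_fixed τ _ hu
      refine ⟨Additive.ofMul (QuotientGroup.mk v), ?_⟩
      rw [subfieldUnits_mk, hv]
      change _ = N • (Additive.ofMul (QuotientGroup.mk u) : UnitsModTorsion K)
      rw [natCast_zsmul]
      rfl
    refine LinearMap.finrank_le_finrank_of_injective
      (f := f.codRestrict (LinearMap.range (subfieldUnits F)) hf) ?_
    rw [LinearMap.injective_codRestrict_iff]
    intro x y hxy
    exact Subtype.ext (smul_right_injective _ hN hxy)
  · rintro _ ⟨x, rfl⟩
    obtain ⟨u, rfl⟩ := exists_ofMul_mk_eq x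
    rw [LinearMap.mem_ker, LinearMap.sub_apply, subfieldUnits_mk, actionModTorsion_mk,
      Module.End.one_apply, sub_eq_zero]
    congr 2
    refine Units.ext (RingOfIntegers.ext ?_)
    exact ((u : 𝓞 F) : F).2 ⟨τ, Subgroup.mem_zpowers τ⟩

end Units

/-! ### Constraints on signatures and completeness of the list of cases -/

section Signature

variable {K : Type*} [Field K] [NumberField K]

theorem rank_eq_of_signature {a b : ℕ} (h : signature K = (a, b)) :
    Units.rank K = a + b - 1 := by
  obtain ⟨rfl, rfl⟩ := Prod.mk.inj h
  rw [Units.rank, InfinitePlace.card_eq_nrRealPlaces_add_nrComplexPlaces]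

theorem signature_sum :
    (signature K).1 + 2 * (signature K).2 = Module.finrank ℚ K :=
  InfinitePlace.card_add_two_mul_card_eq_rank K

theorem finrank_fixedField_mul_orderOf (σ : K ≃ₐ[ℚ] K) :
    Module.finrank ℚ (IntermediateField.fixedField (Subgroup.zpowers σ)) * orderOf σ =
      Module.finrank ℚ K := by
  rw [← Nat.card_zpowers, ← IntermediateField.finrank_fixedField_eq_card,
    Module.finrank_mul_finrank]

theorem signature_fst_eq_zero_of_subfield (F : IntermediateField ℚ K)
    (h : (signature F).1 = 0) : (signature K).1 = 0 := by
  have : IsTotallyComplex F := nrRealPlaces_eq_zero_iff.1 h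
  exact nrRealPlaces_eq_zero_iff.2 (isTotallyComplex_of_algebra F K)

theorem signature_snd_eq_zero_of_subfield (F : IntermediateField ℚ K)
    (h : (signature K).2 = 0) : (signature F).2 = 0 := by
  have : IsTotallyReal K := nrComplexPlaces_eq_zero_iff.1 h
  exact nrComplexPlaces_eq_zero_iff.2 inferInstance

/-- A Galois extension of odd degree is unramified at the infinite places, so no real place becomes
complex. -/
theorem signature_snd_eq_zero_of_odd (F : IntermediateField ℚ K) [IsGalois F K]
    (hodd : Odd (Module.finrank F K)) (h : (signature F).2 = 0) : (signature K).2 = 0 := by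
  have : IsTotallyReal F := nrComplexPlaces_eq_zero_iff.1 h
  have := IsUnramifiedAtInfinitePlaces_of_odd_finrank hodd
  refine nrComplexPlaces_eq_zero_iff.2 ⟨fun w => ?_⟩
  refine (InfinitePlace.isUnramified_iff.1 (w.isUnramified F)).resolve_right fun hc => ?_
  exact InfinitePlace.not_isReal_iff_isComplex.2 hc (IsTotallyReal.isReal _)

/-- The Galois group permutes the infinite places transitively, since `ℚ` has only one, and it
preserves their type. -/
theorem signature_of_isGalois [IsGalois ℚ K] : (signature K).1 = 0 ∨ (signature K).2 = 0 := by
  by_cases h : IsTotallyReal K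
  · exact Or.inr (nrComplexPlaces_eq_zero_iff.2 h)
  · refine Or.inl (nrRealPlaces_eq_zero_iff.2 ⟨fun w => ?_⟩)
    rw [isTotallyReal_iff] at h
    push Not at h
    obtain ⟨v, hv⟩ := h
    obtain ⟨g, rfl⟩ := InfinitePlace.exists_smul_eq_of_comap_eq (k := ℚ) (w := v) (w' := w)
      (Subsingleton.elim _ _)
    rwa [InfinitePlace.isComplex_smul_iff, ← InfinitePlace.not_isReal_iff_isComplex]

theorem isGalois_of_orderOf_eq (σ : K ≃ₐ[ℚ] K) (h : orderOf σ = Module.finrank ℚ K) :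
    IsGalois ℚ K ∧ ∀ τ, τ ∈ Subgroup.zpowers σ := by
  have h1 : Nat.card (Subgroup.zpowers σ) = Module.finrank ℚ K := by rw [Nat.card_zpowers, h]
  have h2 : Nat.card (K ≃ₐ[ℚ] K) ≤ Module.finrank ℚ K := by
    rw [Nat.card_eq_fintype_card]
    exact AlgEquiv.card_le
  have h3 := Subgroup.card_le_card_group (Subgroup.zpowers σ)
  refine ⟨IsGalois.of_card_aut_eq_finrank ℚ K (by omega), fun τ => ?_⟩
  rw [(Subgroup.card_eq_iff_eq_top _).1 (by omega : Nat.card (Subgroup.zpowers σ) = _)]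
  trivial

theorem rank_fixedField_of_totallyReal (σ : K ≃ₐ[ℚ] K) {k : ℕ}
    (hk : k * orderOf σ = Module.finrank ℚ K) (h : (signature K).2 = 0) :
    Units.rank (IntermediateField.fixedField (Subgroup.zpowers σ)) = k - 1 := by
  have h1 := finrank_fixedField_mul_orderOf σ
  rw [← hk] at h1
  have h2 := Nat.eq_of_mul_eq_mul_right (orderOf_pos σ) h1
  have h3 := signature_snd_eq_zero_of_subfield
    (IntermediateField.fixedField (Subgroup.zpowers σ)) h
  have h4 := signature_sum (K := IntermediateField.fixedField (Subgroup.zpowers σ))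
  rw [rank_eq_of_signature (Prod.mk.eta).symm]
  omega

/-- The Galois group is cyclic, so the cubic fixed field is itself Galois over `ℚ`; its odd degree
excludes the totally complex case, and three real places give unit rank `2`. -/
theorem rank_fixedField_cubic (σ : K ≃ₐ[ℚ] K) (h : orderOf σ = Module.finrank ℚ K) {k : ℕ}
    (hk : 3 * orderOf (σ ^ k) = Module.finrank ℚ K) :
    Units.rank (IntermediateField.fixedField (Subgroup.zpowers (σ ^ k))) = 2 := by
  obtain ⟨hG, hz⟩ := isGalois_of_orderOf_eq σ h
  have hn : (Subgroup.zpowers (σ ^ k)).Normal := by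
    refine ⟨fun x hx g => ?_⟩
    obtain ⟨i, rfl⟩ := Subgroup.mem_zpowers_iff.1 (hz x)
    obtain ⟨j, rfl⟩ := Subgroup.mem_zpowers_iff.1 (hz g)
    rwa [← zpow_add, add_comm, zpow_add, mul_inv_cancel_right]
  set F := IntermediateField.fixedField (Subgroup.zpowers (σ ^ k)) with hF
  have h1 : Module.finrank ℚ F = 3 := by
    have h1 := finrank_fixedField_mul_orderOf (σ ^ k)
    rw [← hk] at h1
    exact Nat.eq_of_mul_eq_mul_right (orderOf_pos _) h1
  have hGF : IsGalois ℚ F := IsGalois.of_fixedField_normal_subgroup _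
  have h3 := signature_sum (K := F)
  have h4 := signature_of_isGalois (K := F)
  rw [rank_eq_of_signature (Prod.mk.eta).symm]
  omega

theorem exists_row_of_finrank_mem (hdeg : Module.finrank ℚ K = 4 ∨ Module.finrank ℚ K = 6)
    (σ : K ≃ₐ[ℚ] K) (hσ : σ ≠ 1)
    (h6 : Module.finrank ℚ K = 6 → orderOf σ = 2 → signature K = (0, 3)) :
    ∃ row ∈ table, row.Matches σ := by
  set F := IntermediateField.fixedField (Subgroup.zpowers σ) with hF
  have hFK : Module.finrank ℚ F * orderOf σ = Module.finrank ℚ K :=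
    finrank_fixedField_mul_orderOf σ
  have hm1 : orderOf σ ≠ 1 := mt orderOf_eq_one_iff.1 hσ
  have hK := signature_sum (K := K)
  have hsF := signature_sum (K := F)
  have hFc := signature_fst_eq_zero_of_subfield F
  have hG : orderOf σ = Module.finrank ℚ K → (signature K).1 = 0 ∨ (signature K).2 = 0 := by
    intro h
    have := (isGalois_of_orderOf_eq σ h).1
    exact signature_of_isGalois
  have hodd : orderOf σ = 3 → (signature F).2 = 0 → (signature K).2 = 0 := by
    intro h
    have : IsGalois F K := IsGalois.of_fixed_field K (Subgroup.zpowers σ)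
    refine signature_snd_eq_zero_of_odd F ?_
    rw [IntermediateField.finrank_fixedField_eq_card, Nat.card_zpowers, h]
    decide
  have h1 : Module.finrank ℚ F ≤ 6 := by
    have := orderOf_pos σ
    rcases hdeg with h | h <;> nlinarith
  have key : ∀ d m a b c e : ℕ, Module.finrank ℚ K = d → orderOf σ = m →
      (signature K).1 = a → (signature K).2 = b → (signature F).1 = c → (signature F).2 = e →
      ∀ (i : ℕ) (hi : i < table.length), table[i].deg = d → table[i].ord = m →
        table[i].sign = (a, b) → table[i].signFixed = (c, e) →
        ∃ row ∈ table, row.Matches σ := by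
    intro d m a b c e hd hm ha hb hc he i hi h1 h2 h3 h4
    exact ⟨table[i], List.getElem_mem hi, hd.trans h1.symm, hm.trans h2.symm,
      (Prod.ext ha hb).trans h3.symm, (Prod.ext hc he).trans h4.symm⟩
  have h6a : Module.finrank ℚ K = 6 → orderOf σ = 2 → (signature K).1 = 0 ∧ (signature K).2 = 3 :=
    fun h h' => Prod.ext_iff.1 (h6 h h')
  generalize (signature K).1 = a at *
  generalize (signature K).2 = b at *
  generalize (signature F).1 = c at *
  generalize (signature F).2 = e at *
  generalize Module.finrank ℚ F = f at *
  generalize Module.finrank ℚ K = n at *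
  generalize orderOf σ = m at *
  have hlen : table.length = 12 := rfl
  -- The factorizations `n = f * m` with `m ≠ 1`. In each of them, the constraints on signatures
  -- leave only lines of the table.
  have hfm : n = 4 ∧ f = 1 ∧ m = 4 ∨ n = 4 ∧ f = 2 ∧ m = 2 ∨ n = 6 ∧ f = 1 ∧ m = 6 ∨
      n = 6 ∧ f = 2 ∧ m = 3 ∨ n = 6 ∧ f = 3 ∧ m = 2 := by
    clear key hK hsF hFc hG hodd h6 h6a hlen
    rcases hdeg with rfl | rfl <;> interval_cases f <;>
      first
      | exfalso; omega
      | obtain rfl : m = 2 := by omega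
        decide
      | obtain rfl : m = 3 := by omega
        decide
      | obtain rfl : m = 4 := by omega
        decide
      | obtain rfl : m = 6 := by omega
        decide
  rcases hfm with ⟨rfl, rfl, rfl⟩ | ⟨rfl, rfl, rfl⟩ | ⟨rfl, rfl, rfl⟩ | ⟨rfl, rfl, rfl⟩ |
    ⟨rfl, rfl, rfl⟩
  · have h : a = 4 ∧ b = 0 ∧ c = 1 ∧ e = 0 ∨
        a = 0 ∧ b = 2 ∧ c = 1 ∧ e = 0 := by
      clear key hdeg h1
      omega
    obtain ⟨ha, hb, hc, he⟩ | ⟨ha, hb, hc, he⟩ := h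
    · exact key 4 4 4 0 1 0 rfl rfl ha hb hc he 4 (by omega) rfl rfl rfl rfl
    · exact key 4 4 0 2 1 0 rfl rfl ha hb hc he 5 (by omega) rfl rfl rfl rfl
  · have h : a = 4 ∧ b = 0 ∧ c = 2 ∧ e = 0 ∨
        a = 2 ∧ b = 1 ∧ c = 2 ∧ e = 0 ∨
        a = 0 ∧ b = 2 ∧ c = 0 ∧ e = 1 ∨
        a = 0 ∧ b = 2 ∧ c = 2 ∧ e = 0 := by
      clear key hdeg h1
      omega
    obtain ⟨ha, hb, hc, he⟩ | ⟨ha, hb, hc, he⟩ | ⟨ha, hb, hc, he⟩ | ⟨ha, hb, hc, he⟩ := h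
    · exact key 4 2 4 0 2 0 rfl rfl ha hb hc he 0 (by omega) rfl rfl rfl rfl
    · exact key 4 2 2 1 2 0 rfl rfl ha hb hc he 1 (by omega) rfl rfl rfl rfl
    · exact key 4 2 0 2 0 1 rfl rfl ha hb hc he 2 (by omega) rfl rfl rfl rfl
    · exact key 4 2 0 2 2 0 rfl rfl ha hb hc he 3 (by omega) rfl rfl rfl rfl
  · have h : a = 6 ∧ b = 0 ∧ c = 1 ∧ e = 0 ∨
        a = 0 ∧ b = 3 ∧ c = 1 ∧ e = 0 := by
      clear key hdeg h1
      omega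
    obtain ⟨ha, hb, hc, he⟩ | ⟨ha, hb, hc, he⟩ := h
    · exact key 6 6 6 0 1 0 rfl rfl ha hb hc he 10 (by omega) rfl rfl rfl rfl
    · exact key 6 6 0 3 1 0 rfl rfl ha hb hc he 11 (by omega) rfl rfl rfl rfl
  · have h : a = 6 ∧ b = 0 ∧ c = 2 ∧ e = 0 ∨
        a = 0 ∧ b = 3 ∧ c = 0 ∧ e = 1 := by
      clear key hdeg h1
      omega
    obtain ⟨ha, hb, hc, he⟩ | ⟨ha, hb, hc, he⟩ := h
    · exact key 6 3 6 0 2 0 rfl rfl ha hb hc he 8 (by omega) rfl rfl rfl rfl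
    · exact key 6 3 0 3 0 1 rfl rfl ha hb hc he 9 (by omega) rfl rfl rfl rfl
  · have h : a = 0 ∧ b = 3 ∧ c = 1 ∧ e = 1 ∨
        a = 0 ∧ b = 3 ∧ c = 3 ∧ e = 0 := by
      clear key hdeg h1
      omega
    obtain ⟨ha, hb, hc, he⟩ | ⟨ha, hb, hc, he⟩ := h
    · exact key 6 2 0 3 1 1 rfl rfl ha hb hc he 6 (by omega) rfl rfl rfl rfl
    · exact key 6 2 0 3 3 0 rfl rfl ha hb hc he 7 (by omega) rfl rfl rfl rfl

end Signature

/-! ### Units modulo `ℓ`-th powers -/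

section UnitsModPrime

theorem modN_basis_repr_mkQ {G ι : Type*} [AddCommGroup G] {n : ℕ} [NeZero n] [Fintype ι]
    (b : Module.Basis ι ℤ G) (x : G) (i : ι) :
    (ModN.basis (n := n) b).repr (ModN.mkQ n x) i = (b.repr x i : ZMod n) := by
  classical
  conv_lhs => rw [← b.sum_repr x]
  simp only [map_sum, map_zsmul, ← ModN.basis_apply_eq_mkQ, Module.Basis.repr_self]
  simp [Finsupp.single_apply]

variable {K : Type*} [Field K] [NumberField K]

theorem unitClass_pow (ℓ : ℕ) (u : (𝓞 K)ˣ) (k : ℕ) :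
    unitClass ℓ (u ^ k) = k • unitClass ℓ u := by
  rw [unitClass, ofMul_pow, map_nsmul, unitClass]

theorem unitClass_surjective (ℓ : ℕ) : Function.Surjective (unitClass (K := K) ℓ) :=
  Submodule.mkQ_surjective (LinearMap.range (LinearMap.lsmul ℤ (Additive (𝓞 K)ˣ) ℓ))

theorem unitClass_eq_zero_iff (ℓ : ℕ) (u : (𝓞 K)ˣ) :
    unitClass ℓ u = 0 ↔ ∃ v : (𝓞 K)ˣ, v ^ ℓ = u := by
  refine (Submodule.Quotient.mk_eq_zero _).trans ⟨?_, ?_⟩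
  · rintro ⟨v, hv⟩
    refine ⟨v.toMul, Additive.ofMul.injective ?_⟩
    rw [← hv, ofMul_pow, ofMul_toMul, LinearMap.lsmul_apply, natCast_zsmul]
  · rintro ⟨v, rfl⟩
    refine ⟨Additive.ofMul v, ?_⟩
    rw [ofMul_pow, LinearMap.lsmul_apply, natCast_zsmul]

theorem actionMod_one (ℓ : ℕ) : actionMod (1 : K ≃ₐ[ℚ] K) ℓ = 1 := by
  refine LinearMap.ext fun x => ?_
  obtain ⟨u, rfl⟩ := unitClass_surjective ℓ x
  rw [actionMod_unitClass, unitAction_one, Module.End.one_apply]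

theorem actionMod_mul (σ τ : K ≃ₐ[ℚ] K) (ℓ : ℕ) :
    actionMod (σ * τ) ℓ = actionMod σ ℓ * actionMod τ ℓ := by
  refine LinearMap.ext fun x => ?_
  obtain ⟨u, rfl⟩ := unitClass_surjective ℓ x
  rw [Module.End.mul_apply, actionMod_unitClass, actionMod_unitClass, actionMod_unitClass,
    unitAction_mul]

theorem actionMod_pow (σ : K ≃ₐ[ℚ] K) (ℓ k : ℕ) : actionMod (σ ^ k) ℓ = actionMod σ ℓ ^ k := by
  induction k with
  | zero => rw [pow_zero, pow_zero, actionMod_one]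
  | succ k ih => rw [pow_succ, pow_succ, actionMod_mul, ih]

theorem actionMod_pow_orderOf (σ : K ≃ₐ[ℚ] K) (ℓ : ℕ) : actionMod σ ℓ ^ orderOf σ = 1 := by
  rw [← actionMod_pow, pow_orderOf_eq_one, actionMod_one]

variable (K) in
theorem range_lsmul_le_comap_mk (ℓ : ℕ) :
    LinearMap.range (LinearMap.lsmul ℤ (Additive (𝓞 K)ˣ) ℓ) ≤
      (LinearMap.range (LinearMap.lsmul ℤ (UnitsModTorsion K) ℓ)).comap
        (MonoidHom.toAdditive (QuotientGroup.mk' (Units.torsion K))).toIntLinearMap := by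
  rintro _ ⟨u, rfl⟩
  exact ⟨(MonoidHom.toAdditive (QuotientGroup.mk' (Units.torsion K))).toIntLinearMap u, by simp⟩

variable (K) in
/-- The canonical map from `U / U^ℓ` to `(U / U_tor) / ℓ`. -/
def unitsModToModTorsion (ℓ : ℕ) : UnitsMod K ℓ →ₗ[ZMod ℓ] ModN (UnitsModTorsion K) ℓ :=
  AddMonoidHom.toZModLinearMap ℓ
    (Submodule.mapQ _ _
      (MonoidHom.toAdditive (QuotientGroup.mk' (Units.torsion K))).toIntLinearMap
      (range_lsmul_le_comap_mk K ℓ)).toAddMonoidHom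

theorem unitsModToModTorsion_unitClass (ℓ : ℕ) (u : (𝓞 K)ˣ) :
    unitsModToModTorsion K ℓ (unitClass ℓ u) =
      ModN.mkQ ℓ (Additive.ofMul (QuotientGroup.mk u) : UnitsModTorsion K) := rfl

/-- With no root of unity of order `ℓ`, the order of a torsion unit is prime to `ℓ`, so raising to
the power `ℓ` is invertible on the group it generates. -/
theorem exists_pow_eq_of_mem_torsion {ℓ : ℕ} (hℓ : ℓ.Prime) (hK : ∀ ζ : K, ζ ^ ℓ = 1 → ζ = 1)
    {u : (𝓞 K)ˣ} (hu : u ∈ Units.torsion K) : ∃ v : (𝓞 K)ˣ, v ^ ℓ = u := by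
  have hpos : 0 < orderOf u := orderOf_pos_iff.2 hu
  have hco : ℓ.Coprime (orderOf u) := by
    rw [hℓ.coprime_iff_not_dvd]
    rintro ⟨k, hk⟩
    have h1 : u ^ k = 1 := by
      refine Units.ext (RingOfIntegers.ext (hK _ ?_))
      have : (u ^ k) ^ ℓ = 1 := by rw [← pow_mul, mul_comm, ← hk, pow_orderOf_eq_one]
      simpa using congrArg (fun w : (𝓞 K)ˣ => ((w : 𝓞 K) : K)) this
    have h2 : 0 < k := Nat.pos_of_ne_zero fun h => by
      rw [hk, h, mul_zero] at hpos
      exact hpos.false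
    have h3 := Nat.le_of_dvd h2 (orderOf_dvd_of_pow_eq_one h1)
    rw [hk] at h3
    have := hℓ.two_le
    nlinarith
  obtain ⟨j, hj⟩ := exists_pow_eq_self_of_coprime hco
  exact ⟨u ^ j, by rw [← pow_mul, mul_comm, pow_mul, hj]⟩

theorem unitsModToModTorsion_bijective {ℓ : ℕ} (hℓ : ℓ.Prime)
    (hK : ∀ ζ : K, ζ ^ ℓ = 1 → ζ = 1) : Function.Bijective (unitsModToModTorsion K ℓ) := by
  constructor
  · rw [injective_iff_map_eq_zero]
    intro x hx
    obtain ⟨u, rfl⟩ := unitClass_surjective ℓ x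
    rw [unitsModToModTorsion_unitClass] at hx
    obtain ⟨y, hy⟩ := (Submodule.Quotient.mk_eq_zero _).1 hx
    obtain ⟨v, rfl⟩ := exists_ofMul_mk_eq y
    rw [LinearMap.lsmul_apply, natCast_zsmul, ← ofMul_pow, ← QuotientGroup.mk_pow, eq_comm,
      ← sub_eq_zero, ← ofMul_div, ← QuotientGroup.mk_div, ofMul_mk_eq_zero] at hy
    obtain ⟨w, hw⟩ := exists_pow_eq_of_mem_torsion hℓ hK hy
    exact (unitClass_eq_zero_iff ℓ u).2 ⟨w * v, by rw [mul_pow, hw, div_mul_cancel]⟩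
  · intro x
    obtain ⟨y, rfl⟩ := Submodule.mkQ_surjective _ x
    obtain ⟨u, rfl⟩ := exists_ofMul_mk_eq y
    exact ⟨unitClass ℓ u, rfl⟩

/-- The basis of `U / U^ℓ` given by the fundamental units. -/
def unitsModBasis {ℓ : ℕ} (hℓ : ℓ.Prime) (hK : ∀ ζ : K, ζ ^ ℓ = 1 → ζ = 1) :
    Module.Basis (Fin (Units.rank K)) (ZMod ℓ) (UnitsMod K ℓ) :=
  haveI : NeZero ℓ := ⟨hℓ.ne_zero⟩
  (ModN.basis (Units.basisModTorsion K)).map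
    (LinearEquiv.ofBijective _ (unitsModToModTorsion_bijective hℓ hK)).symm

theorem unitsModBasis_apply {ℓ : ℕ} (hℓ : ℓ.Prime) (hK : ∀ ζ : K, ζ ^ ℓ = 1 → ζ = 1)
    (i : Fin (Units.rank K)) :
    unitsModBasis hℓ hK i = unitClass ℓ (Units.fundSystem K i) := by
  have : NeZero ℓ := ⟨hℓ.ne_zero⟩
  rw [unitsModBasis, Module.Basis.map_apply, LinearEquiv.symm_apply_eq,
    ModN.basis_apply_eq_mkQ, ← Units.fundSystem_mk]
  rfl

theorem unitsModBasis_repr_unitClass {ℓ : ℕ} (hℓ : ℓ.Prime) (hK : ∀ ζ : K, ζ ^ ℓ = 1 → ζ = 1)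
    (u : (𝓞 K)ˣ) (i : Fin (Units.rank K)) :
    (unitsModBasis hℓ hK).repr (unitClass ℓ u) i =
      ((Units.basisModTorsion K).repr (Additive.ofMul (QuotientGroup.mk u)) i : ZMod ℓ) := by
  have : NeZero ℓ := ⟨hℓ.ne_zero⟩
  rw [← modN_basis_repr_mkQ]
  rfl

theorem finite_unitsMod {ℓ : ℕ} (hℓ : ℓ.Prime) (hK : ∀ ζ : K, ζ ^ ℓ = 1 → ζ = 1) :
    Module.Finite (ZMod ℓ) (UnitsMod K ℓ) := .of_basis (unitsModBasis hℓ hK)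

theorem finrank_unitsMod {ℓ : ℕ} [Fact ℓ.Prime] (hK : ∀ ζ : K, ζ ^ ℓ = 1 → ζ = 1) :
    Module.finrank (ZMod ℓ) (UnitsMod K ℓ) = Units.rank K := by
  rw [Module.finrank_eq_card_basis (unitsModBasis Fact.out hK), Fintype.card_fin]

/-- In the basis of fundamental units, the matrix of `σ` on `U / U^ℓ` is the entrywise reduction of
its matrix on `U / U_tor`. -/
theorem charpoly_actionMod {ℓ : ℕ} [Fact ℓ.Prime] [Module.Finite (ZMod ℓ) (UnitsMod K ℓ)]
    (hK : ∀ ζ : K, ζ ^ ℓ = 1 → ζ = 1) (σ : K ≃ₐ[ℚ] K) :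
    LinearMap.charpoly (actionMod σ ℓ) =
      (LinearMap.charpoly (actionModTorsion σ)).map (Int.castRingHom (ZMod ℓ)) := by
  rw [← LinearMap.charpoly_toMatrix _ (unitsModBasis Fact.out hK),
    ← LinearMap.charpoly_toMatrix _ (Units.basisModTorsion K), ← Matrix.charpoly_map]
  congr 1
  ext i j
  rw [Matrix.map_apply, LinearMap.toMatrix_apply, LinearMap.toMatrix_apply, unitsModBasis_apply,
    actionMod_unitClass, unitsModBasis_repr_unitClass, ← Units.fundSystem_mk]
  rfl

/-- If `A` is a primitive root of unity modulo `ℓ` of the order of `σ`, then the dimension of the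
eigenspace `E_A` is the multiplicity of the corresponding cyclotomic polynomial. -/
theorem finrank_unitEigenspace {ℓ : ℕ} [Fact ℓ.Prime] (hK : ∀ ζ : K, ζ ^ ℓ = 1 → ζ = 1)
    (σ : K ≃ₐ[ℚ] K) (hσ : ¬ ℓ ∣ orderOf σ) {A : ZMod ℓ} (hA : IsPrimitiveRoot A (orderOf σ))
    {a : ℕ → ℕ} (ha : (actionModTorsion σ).charpoly =
      ∏ d ∈ (orderOf σ).divisors, cyclotomic d ℤ ^ a d) :
    Module.finrank (ZMod ℓ) (unitEigenspace σ ℓ A) = a (orderOf σ) := by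
  have := finite_unitsMod Fact.out hK
  have hm : (orderOf σ : ZMod ℓ) ≠ 0 := by rwa [Ne, ZMod.natCast_eq_zero_iff]
  rw [unitEigenspace, finrank_eigenspace_eq_rootMultiplicity _ hm (actionMod_pow_orderOf σ ℓ),
    charpoly_actionMod hK, ha, rootMultiplicity_prod_cyclotomic hm dvd_rfl hA]

theorem isCompl_unitEigenspace {ℓ : ℕ} [Fact ℓ.Prime] (σ : K ≃ₐ[ℚ] K) {A : ZMod ℓ}
    (hA : IsPrimitiveRoot A (orderOf σ)) :
    IsCompl (⨆ c : {c : ZMod ℓ // c ≠ A}, unitEigenspace σ ℓ c) (unitEigenspace σ ℓ A) :=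
  isCompl_eigenspace _ (orderOf_pos σ) (actionMod_pow_orderOf σ ℓ) hA A

theorem numVanishing_add_finrank {ℓ : ℕ} [Fact ℓ.Prime] (hK : ∀ ζ : K, ζ ^ ℓ = 1 → ζ = 1)
    (σ : K ≃ₐ[ℚ] K) {A : ZMod ℓ} (hA : IsPrimitiveRoot A (orderOf σ)) :
    numVanishing σ ℓ A + Module.finrank (ZMod ℓ) (unitEigenspace σ ℓ A) = Units.rank K := by
  have := finite_unitsMod Fact.out hK
  rw [← finrank_unitsMod hK]
  exact Submodule.finrank_add_eq_of_isCompl (isCompl_unitEigenspace σ hA)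

end UnitsModPrime

/-! ### Discrete logarithms and the order of `A` -/

section DiscreteLog

/-- The bound on the cardinality excludes `𝔽_2`, where `g = 0` satisfies `hg` because `0 ^ 0 = 1`.
-/
theorem orderOf_eq_card_sub_one {F : Type*} [Field F] [Finite F] {g : F}
    (hg : ∀ y : F, y ≠ 0 → ∃ k : ℕ, g ^ k = y) (hF : 2 < Nat.card F) :
    orderOf g = Nat.card F - 1 := by
  have hg0 : g ≠ 0 := by
    rintro rfl
    have hle : Nat.card F ≤ 2 := by
      have : (Set.univ : Set F) ⊆ ({0, 1} : Set F) := fun y _ => by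
        by_cases hy : y = 0
        · simp [hy]
        · obtain ⟨k, rfl⟩ := hg y hy
          rcases k with _ | k <;> simp
      rw [← Set.ncard_univ]
      exact (Set.ncard_le_ncard this).trans ((Set.ncard_insert_le 0 {1}).trans (by simp))
    omega
  rw [← Nat.card_units, ← Units.val_mk0 hg0, orderOf_units]
  refine orderOf_eq_card_of_forall_mem_zpowers fun x => ?_
  obtain ⟨k, hk⟩ := hg x x.ne_zero
  exact ⟨k, Units.ext (by simpa using hk)⟩

theorem discreteLog_pow {F : Type*} [Field F] [Finite F] {g : F}
    (hg : ∀ y : F, y ≠ 0 → ∃ k : ℕ, g ^ k = y) (hF : 2 < Nat.card F) {ℓ : ℕ}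
    (hℓ : ℓ ∣ Nat.card F - 1) (k : ℕ) : (discreteLog g (g ^ k) : ZMod ℓ) = k := by
  have hmem : g ^ discreteLog g (g ^ k) = g ^ k := Nat.sInf_mem (s := {j | g ^ j = g ^ k}) ⟨k, rfl⟩
  have hpos : 0 < orderOf g := by
    rw [orderOf_eq_card_sub_one hg hF]
    omega
  have hmod : discreteLog g (g ^ k) ≡ k [MOD orderOf g] :=
    (orderOf_pos_iff.1 hpos).pow_eq_pow_iff_modEq.1 hmem
  rw [orderOf_eq_card_sub_one hg hF] at hmod
  exact (ZMod.natCast_eq_natCast_iff _ _ _).2 (hmod.of_dvd hℓ)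

variable {K : Type*} [Field K] [NumberField K]

theorem isMaximal_of_finite_quotient {𝔭 : Ideal (𝓞 K)} (h𝔭 : 𝔭.IsPrime)
    (hfin : Finite (𝓞 K ⧸ 𝔭)) : 𝔭.IsMaximal :=
  Ideal.Quotient.maximal_of_isField _ (Finite.isField_of_domain (𝓞 K ⧸ 𝔭))

section Log

variable {𝔭 : Ideal (𝓞 K)} {g : 𝓞 K ⧸ 𝔭} {ℓ : ℕ}

theorem exists_logRho_eq (hg : ∀ y : 𝓞 K ⧸ 𝔭, y ≠ 0 → ∃ k : ℕ, g ^ k = y)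
    (hlog : ∀ k : ℕ, (discreteLog g (g ^ k) : ZMod ℓ) = k) {x : 𝓞 K} (hx : x ∉ 𝔭) :
    ∃ k : ℕ, Ideal.Quotient.mk 𝔭 x = g ^ k ∧ logRho 𝔭 g ℓ x = k := by
  obtain ⟨k, hk⟩ := hg (Ideal.Quotient.mk 𝔭 x) (mt Ideal.Quotient.eq_zero_iff_mem.1 hx)
  exact ⟨k, hk.symm, by rw [logRho, ← hk, hlog]⟩

theorem logRho_mul (hg : ∀ y : 𝓞 K ⧸ 𝔭, y ≠ 0 → ∃ k : ℕ, g ^ k = y)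
    (hlog : ∀ k : ℕ, (discreteLog g (g ^ k) : ZMod ℓ) = k) {x y : 𝓞 K} (hx : x ∉ 𝔭)
    (hy : y ∉ 𝔭) : logRho 𝔭 g ℓ (x * y) = logRho 𝔭 g ℓ x + logRho 𝔭 g ℓ y := by
  obtain ⟨j, hj, hj'⟩ := exists_logRho_eq hg hlog hx
  obtain ⟨k, hk, hk'⟩ := exists_logRho_eq hg hlog hy
  rw [hj', hk', logRho, map_mul, hj, hk, ← pow_add, hlog, Nat.cast_add]

theorem logRho_pow (hg : ∀ y : 𝓞 K ⧸ 𝔭, y ≠ 0 → ∃ k : ℕ, g ^ k = y)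
    (hlog : ∀ k : ℕ, (discreteLog g (g ^ k) : ZMod ℓ) = k) {x : 𝓞 K} (hx : x ∉ 𝔭) (n : ℕ) :
    logRho 𝔭 g ℓ (x ^ n) = n * logRho 𝔭 g ℓ x := by
  obtain ⟨j, hj, hj'⟩ := exists_logRho_eq hg hlog hx
  rw [hj', logRho, map_pow, hj, ← pow_mul, hlog, Nat.cast_mul, mul_comm]

end Log

theorem norm_intAction (σ : K ≃ₐ[ℚ] K) (x : 𝓞 K) :
    Algebra.norm ℤ (intAction σ x) = Algebra.norm ℤ x := by
  refine Int.cast_injective (α := ℚ) ?_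
  rw [Algebra.coe_norm_int, Algebra.coe_norm_int, coe_intAction, Algebra.norm_eq_of_algEquiv]

theorem isCoprime_norm_unit (u : (𝓞 K)ˣ) (p : ℤ) :
    IsCoprime (Algebra.norm ℤ (u : 𝓞 K)) p :=
  isCoprime_one_left.of_isCoprime_of_dvd_left (u.isUnit.map (Algebra.norm ℤ)).dvd

theorem logCompatible_pow {σ : K ≃ₐ[ℚ] K} {p : ℕ} {𝔭 : Ideal (𝓞 K)} {g : 𝓞 K ⧸ 𝔭} {ℓ : ℕ} {A : ℤ}
    (h : LogCompatible σ p 𝔭 g ℓ A) (k : ℕ) : LogCompatible (σ ^ k) p 𝔭 g ℓ (A ^ k) := by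
  induction k with
  | zero =>
    intro x _
    rw [pow_zero, pow_zero, Int.cast_one, one_mul]
    rfl
  | succ k ih =>
    intro x hx
    have h1 : intAction (σ ^ (k + 1)) x = intAction σ (intAction (σ ^ k) x) := by
      rw [pow_succ']
      exact RingOfIntegers.ext rfl
    rw [h1, h _ (by rwa [norm_intAction]), ih x hx, pow_succ', Int.cast_mul, mul_assoc]

theorem natCast_mem_of_card_quotient {𝔭 : Ideal (𝓞 K)} (h𝔭 : 𝔭.IsPrime) {p n : ℕ}
    (hcard : Nat.card (𝓞 K ⧸ 𝔭) = p ^ n) : (p : 𝓞 K) ∈ 𝔭 := by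
  refine h𝔭.mem_of_pow_mem n ?_
  have h := Ideal.absNorm_mem 𝔭
  rwa [Ideal.absNorm_apply, Submodule.cardQuot_apply, hcard, Nat.cast_pow] at h

/-- `LogCompatible` only concerns elements of norm prime to `p`. The Chinese remainder theorem lifts
`y` to an element congruent to `1` modulo every other prime above `p`, so that no prime above `p`
contains it. -/
theorem exists_mk_eq_and_isCoprime_norm {𝔭 : Ideal (𝓞 K)} (h𝔭 : 𝔭.IsMaximal) {p : ℕ}
    (hp : p.Prime) (y : 𝓞 K ⧸ 𝔭) (hy : y ≠ 0) :
    ∃ x : 𝓞 K, Ideal.Quotient.mk 𝔭 x = y ∧ IsCoprime (Algebra.norm ℤ x) (p : ℤ) := by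
  classical
  obtain ⟨y, rfl⟩ := Ideal.Quotient.mk_surjective y
  have hp0 : (p : 𝓞 K) ≠ 0 := Nat.cast_ne_zero.2 hp.ne_zero
  let S : Set (Ideal (𝓞 K)) := {𝔮 | 𝔮.IsMaximal ∧ (p : 𝓞 K) ∈ 𝔮}
  have hS : S.Finite := by
    refine ((Ideal.finite_factors (I := Ideal.span {(p : 𝓞 K)}) (by simpa using hp0)).image
      fun v => v.asIdeal).subset ?_
    rintro 𝔮 ⟨hmax, hmem⟩
    have hne : 𝔮 ≠ ⊥ := by
      rintro rfl
      exact hp0 hmem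
    exact ⟨⟨𝔮, hmax.isPrime, hne⟩, Ideal.dvd_span_singleton.2 hmem, rfl⟩
  -- `𝔭` is not assumed to lie above `p`, hence the insertion.
  have hT : (insert 𝔭 S).Finite := hS.insert 𝔭
  have := hT.to_subtype
  have hmax : ∀ 𝔮 : (insert 𝔭 S : Set (Ideal (𝓞 K))), 𝔮.1.IsMaximal := by
    rintro ⟨𝔮, rfl | h⟩
    exacts [h𝔭, h.1]
  obtain ⟨r, hr⟩ := Ideal.exists_forall_sub_mem_ideal
    (I := fun 𝔮 : (insert 𝔭 S : Set (Ideal (𝓞 K))) => 𝔮.1)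
    (fun i j hij => by
      have := hmax i
      have := hmax j
      exact Ideal.isCoprime_of_isMaximal fun h => hij (Subtype.ext h))
    (fun 𝔮 => if 𝔮.1 = 𝔭 then y else 1)
  have hr𝔭 : r - y ∈ 𝔭 := by simpa using hr ⟨𝔭, Set.mem_insert _ _⟩
  refine ⟨r, Ideal.Quotient.eq.2 hr𝔭, ?_⟩
  rw [isCoprime_comm, Prime.coprime_iff_not_dvd (Nat.prime_iff_prime_int.1 hp)]
  intro hdvd
  have hN : p ∣ Ideal.absNorm (Ideal.span {r}) := by
    rw [Ideal.absNorm_span_singleton]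
    exact Int.natCast_dvd.1 hdvd
  obtain ⟨P, hP, hPp, hPr⟩ := Ideal.exists_isMaximal_dvd_of_dvd_absNorm' hp _ hN
  have hrP : r ∈ P := Ideal.dvd_span_singleton.1 hPr
  have hpP : (p : 𝓞 K) ∈ P := by
    have : (p : ℤ) ∈ P.under ℤ := hPp ▸ Ideal.mem_span_singleton_self _
    simpa [Ideal.mem_comap] using this
  by_cases h : P = 𝔭
  · subst h
    refine hy (Ideal.Quotient.eq_zero_iff_mem.2 ?_)
    simpa using P.sub_mem hrP hr𝔭
  · have h1 := hr ⟨P, Set.mem_insert_of_mem _ ⟨hP, hpP⟩⟩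
    simp only [if_neg h] at h1
    exact hP.ne_top ((Ideal.eq_top_iff_one _).2 (by simpa using P.sub_mem hrP h1))

/-- Apply the relation for `σ ^ orderOf σ = 1` to a lift of `g`, whose logarithm is `1`. -/
theorem pow_orderOf_eq_one_of_logCompatible {σ : K ≃ₐ[ℚ] K} {p ℓ : ℕ} (hp : p.Prime)
    {𝔭 : Ideal (𝓞 K)} (h𝔭 : 𝔭.IsMaximal) {g : 𝓞 K ⧸ 𝔭}
    (hg0 : g ≠ 0) (hlog : ∀ k : ℕ, (discreteLog g (g ^ k) : ZMod ℓ) = k) {A : ℤ}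
    (hA : LogCompatible σ p 𝔭 g ℓ A) : (A : ZMod ℓ) ^ orderOf σ = 1 := by
  obtain ⟨x, hx, hco⟩ := exists_mk_eq_and_isCoprime_norm h𝔭 hp g hg0
  have h1 := logCompatible_pow hA (orderOf σ) x hco
  have h2 : logRho 𝔭 g ℓ x = 1 := by
    have := hlog 1
    rw [pow_one, Nat.cast_one] at this
    rw [logRho, hx, this]
  have h3 : intAction (σ ^ orderOf σ) x = x := by
    rw [pow_orderOf_eq_one]
    rfl
  rw [h3, h2, mul_one, Int.cast_pow] at h1
  exact h1.symm

/-- When `σ` generates the Galois group, the Frobenius at `𝔭` is a power of `σ`. -/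
theorem exists_pow_eq_of_isGalois {σ : K ≃ₐ[ℚ] K} [IsGalois ℚ K]
    (hσ : ∀ τ, τ ∈ Subgroup.zpowers σ) {p ℓ n : ℕ} (hp : p.Prime)
    {𝔭 : Ideal (𝓞 K)} (h𝔭 : 𝔭.IsMaximal) (hcard : Nat.card (𝓞 K ⧸ 𝔭) = p ^ n)
    {g : 𝓞 K ⧸ 𝔭} (hg : ∀ y : 𝓞 K ⧸ 𝔭, y ≠ 0 → ∃ k : ℕ, g ^ k = y)
    (hg0 : g ≠ 0) (hlog : ∀ k : ℕ, (discreteLog g (g ^ k) : ZMod ℓ) = k) {A : ℤ}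
    (hA : LogCompatible σ p 𝔭 g ℓ A) : ∃ i : ℕ, (A : ZMod ℓ) ^ i = p := by
  have hfin : Finite (𝓞 K ⧸ 𝔭) := Nat.finite_of_card_ne_zero (hcard ▸ pow_ne_zero _ hp.ne_zero)
  have hpmem := natCast_mem_of_card_quotient h𝔭.isPrime hcard
  have hunder : 𝔭.under ℤ = Ideal.span {(p : ℤ)} := by
    have hm : (Ideal.span {(p : ℤ)}).IsMaximal :=
      PrincipalIdealRing.isMaximal_of_irreducible (Nat.prime_iff_prime_int.1 hp).irreducible
    refine (hm.eq_of_le ?_ ?_).symm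
    · exact (Ideal.IsPrime.under ℤ 𝔭).ne_top
    · rw [Ideal.span_singleton_le_iff_mem, Ideal.mem_comap]
      simpa using hpmem
  have hq : Nat.card (ℤ ⧸ 𝔭.under ℤ) = p := by
    rw [hunder, Nat.card_congr (Int.quotientSpanNatEquivZMod p).toEquiv, Nat.card_zmod]
  obtain ⟨s, hs⟩ := IsArithFrobAt.exists_of_isInvariant ℤ (K ≃ₐ[ℚ] K) 𝔭
  obtain ⟨i, rfl⟩ := mem_powers_iff_mem_zpowers.2 (hσ s)
  obtain ⟨x, hx, hco⟩ := exists_mk_eq_and_isCoprime_norm h𝔭 hp g hg0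
  have hx𝔭 : x ∉ 𝔭 := fun h => hg0 (hx ▸ Ideal.Quotient.eq_zero_iff_mem.2 h)
  have h1 := logCompatible_pow hA i x hco
  have h2 : logRho 𝔭 g ℓ x = 1 := by
    have := hlog 1
    rw [pow_one, Nat.cast_one] at this
    rw [logRho, hx, this]
  -- The Frobenius `σ ^ i` acts on the residue field as the `p`-th power. On a lift of `g` the
  -- logarithm of the image is thus both `A ^ i` and `p`.
  have h3 : Ideal.Quotient.mk 𝔭 (intAction (σ ^ i) x) = Ideal.Quotient.mk 𝔭 (x ^ p) := by
    rw [map_pow, ← hq]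
    exact hs.mk_apply x
  have h4 : logRho 𝔭 g ℓ (intAction (σ ^ i) x) = logRho 𝔭 g ℓ (x ^ p) := by
    rw [logRho, h3, logRho]
  rw [h4, logRho_pow hg hlog hx𝔭, h2, mul_one, mul_one, Int.cast_pow] at h1
  exact ⟨i, h1.symm⟩

/-- As `p ∈ 𝔭`, the norm `p ^ n` of `𝔭` divides the norm `p ^ [K : ℚ]` of `(p)`. -/
theorem le_finrank_of_card_quotient {𝔭 : Ideal (𝓞 K)} (h𝔭 : 𝔭.IsPrime) {p n : ℕ} (hp : p.Prime)
    (hcard : Nat.card (𝓞 K ⧸ 𝔭) = p ^ n) : n ≤ Module.finrank ℚ K := by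
  have h := Ideal.absNorm_dvd_absNorm_of_le
    ((Ideal.span_singleton_le_iff_mem 𝔭).2 (natCast_mem_of_card_quotient h𝔭 hcard))
  rw [Ideal.absNorm_apply 𝔭, Submodule.cardQuot_apply, hcard, Ideal.absNorm_span_singleton,
    Algebra.norm_natCast, Int.natAbs_pow, Int.natAbs_natCast,
    RingOfIntegers.rank] at h
  exact (Nat.pow_dvd_pow_iff_le_right hp.one_lt).1 h

theorem isPrimitiveRoot_of_prime {M : Type*} [CommMonoid M] {A : M} {m : ℕ} (hm : m.Prime)
    (h : A ^ m = 1) (h1 : A ≠ 1) : IsPrimitiveRoot A m := by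
  have := Fact.mk hm
  exact IsPrimitiveRoot.iff_orderOf.2 (orderOf_eq_prime h h1)

/-- In a field of degree `orderOf σ`, the factor `A` has order `orderOf σ` modulo `ℓ`. -/
theorem isPrimitiveRoot_of_orderOf_eq_finrank {σ : K ≃ₐ[ℚ] K}
    (hσ : orderOf σ = Module.finrank ℚ K) {p ℓ n : ℕ} (hp : p.Prime) [Fact ℓ.Prime]
    {𝔭 : Ideal (𝓞 K)} (h𝔭 : 𝔭.IsMaximal) (hcard : Nat.card (𝓞 K ⧸ 𝔭) = p ^ n)
    (hn : orderOf σ ∣ n) (hn0 : n ≠ 0) (hΦ : (ℓ : ℤ) ∣ (cyclotomic n ℤ).eval (p : ℤ))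
    (hℓ : ¬ ℓ ∣ orderOf σ)
    {g : 𝓞 K ⧸ 𝔭} (hg : ∀ y : 𝓞 K ⧸ 𝔭, y ≠ 0 → ∃ k : ℕ, g ^ k = y)
    (hg0 : g ≠ 0) (hlog : ∀ k : ℕ, (discreteLog g (g ^ k) : ZMod ℓ) = k) {A : ℤ}
    (hA : LogCompatible σ p 𝔭 g ℓ A) : IsPrimitiveRoot (A : ZMod ℓ) (orderOf σ) := by
  obtain ⟨hG, hz⟩ := isGalois_of_orderOf_eq σ hσ
  obtain ⟨i, hi⟩ := exists_pow_eq_of_isGalois hz hp h𝔭 hcard hg hg0 hlog hA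
  have hnσ : n = orderOf σ := le_antisymm
    (hσ ▸ le_finrank_of_card_quotient h𝔭.isPrime hp hcard)
    (Nat.le_of_dvd (Nat.pos_of_ne_zero hn0) hn)
  have hne : NeZero (n : ZMod ℓ) := ⟨by rwa [Ne, ZMod.natCast_eq_zero_iff, hnσ]⟩
  have hroot : (cyclotomic n (ZMod ℓ)).IsRoot (p : ZMod ℓ) := by
    have h1 := (ZMod.intCast_zmod_eq_zero_iff_dvd _ ℓ).2 hΦ
    rw [← eq_intCast (Int.castRingHom (ZMod ℓ)), ← eval_map_apply, map_cyclotomic] at h1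
    simpa using h1
  -- As `ℓ ∤ n`, a root of `Φ_n` modulo `ℓ` has exact order `n`. Since `p` is a power of `A`, this
  -- order divides that of `A`.
  have hprim := isRoot_cyclotomic_iff.1 hroot
  have h1 : orderOf (A : ZMod ℓ) ∣ orderOf σ :=
    orderOf_dvd_of_pow_eq_one (pow_orderOf_eq_one_of_logCompatible hp h𝔭 hg0 hlog hA)
  have h2 : orderOf σ ∣ orderOf (A : ZMod ℓ) := by
    rw [← hnσ, hprim.eq_orderOf, ← hi]
    exact orderOf_pow_dvd i
  exact IsPrimitiveRoot.iff_orderOf.2 (Nat.dvd_antisymm h1 h2)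

/-- Write `σ(u) = v ^ ℓ * u ^ c`. The factor `v ^ ℓ` has logarithm `0` modulo `ℓ`, so `(c - A) log u
= 0`. -/
theorem logRho_eq_zero_of_mem_unitEigenspace {σ : K ≃ₐ[ℚ] K} {p ℓ : ℕ} [Fact ℓ.Prime]
    {𝔭 : Ideal (𝓞 K)} (h𝔭 : 𝔭.IsPrime)
    {g : 𝓞 K ⧸ 𝔭} (hg : ∀ y : 𝓞 K ⧸ 𝔭, y ≠ 0 → ∃ k : ℕ, g ^ k = y)
    (hlog : ∀ k : ℕ, (discreteLog g (g ^ k) : ZMod ℓ) = k) {A : ℤ}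
    (hA : LogCompatible σ p 𝔭 g ℓ A) {c : ZMod ℓ} (hc : c ≠ A) {u : (𝓞 K)ˣ}
    (hu : unitClass ℓ u ∈ unitEigenspace σ ℓ c) : logRho 𝔭 g ℓ (u : 𝓞 K) = 0 := by
  have hnot : ∀ w : (𝓞 K)ˣ, (w : 𝓞 K) ∉ 𝔭 := fun w hw =>
    h𝔭.ne_top (Ideal.eq_top_of_isUnit_mem _ hw w.isUnit)
  have h1 := Module.End.mem_eigenspace_iff.1 hu
  rw [actionMod_unitClass, ← ZMod.natCast_zmod_val c, Nat.cast_smul_eq_nsmul, ← unitClass_pow,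
    ← sub_eq_zero] at h1
  have h2 : unitClass ℓ (unitAction σ u / u ^ c.val) = 0 := h1
  obtain ⟨v, hv⟩ := (unitClass_eq_zero_iff ℓ _).1 h2
  have h3 : unitAction σ u = v ^ ℓ * u ^ c.val := by rw [hv, div_mul_cancel]
  have h4 := hA u (isCoprime_norm_unit u p)
  rw [← coe_unitAction, h3, Units.val_mul, Units.val_pow_eq_pow_val,
    Units.val_pow_eq_pow_val, logRho_mul hg hlog (by simpa using hnot (v ^ ℓ))
      (by simpa using hnot (u ^ c.val)), logRho_pow hg hlog (hnot v), logRho_pow hg hlog (hnot u),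
    ZMod.natCast_self, zero_mul, zero_add, ZMod.natCast_zmod_val, ← sub_eq_zero, ← sub_mul,
    mul_eq_zero] at h4
  exact h4.resolve_left (sub_ne_zero.2 hc)

end DiscreteLog

/-! ### Bases of eigenvectors and reduction of a line of the table to its exponents -/

theorem exists_adapted_basis {F V ι : Type*} [Field F] [AddCommGroup V] [Module F V]
    [FiniteDimensional F V] (E : ι → Submodule F V) (W : Submodule F V)
    (h : IsCompl (⨆ i, E i) W) {R r : ℕ} (hR : Module.finrank F (⨆ i, E i : Submodule F V) = R)
    (hr : Module.finrank F V = r) :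
    ∃ v : Fin r → V, LinearIndependent F v ∧ Submodule.span F (Set.range v) = ⊤ ∧
      (∀ i : Fin r, (i : ℕ) < R → ∃ c, v i ∈ E c) ∧ ∀ i : Fin r, R ≤ (i : ℕ) → v i ∈ W := by
  -- Extracting a basis from the union of the `E i`, which spans their sum, keeps every basis vector
  -- inside a single `E i`.
  obtain ⟨b, hb, hspan, hli⟩ := exists_linearIndependent F (⋃ i, (E i : Set V))
  rw [Submodule.span_iUnion] at hspan
  simp only [Submodule.span_eq] at hspan
  have hbfin : Finite b := hli.finite
  have := Fintype.ofFinite b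
  have hcard : Nat.card b = R := by
    rw [Nat.card_eq_fintype_card, ← Set.toFinset_card, ← finrank_span_set_eq_card hli, hspan, hR]
  let e₁ : Fin R ≃ b := (Finite.equivFinOfCardEq hcard).symm
  let bW := Module.finBasis F W
  have hsum := Submodule.finrank_add_eq_of_isCompl h
  rw [hR, hr] at hsum
  let e : Fin r ≃ Fin R ⊕ Fin (Module.finrank F W) :=
    (finCongr hsum.symm).trans finSumFinEquiv.symm
  let v₁ : Fin R → V := fun i => e₁ i
  let v₂ : Fin (Module.finrank F W) → V := fun i => bW i
  have hv₁ : LinearIndependent F v₁ := hli.comp _ e₁.injective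
  have hv₂ : LinearIndependent F v₂ := bW.linearIndependent.map' W.subtype W.ker_subtype
  have hs₁ : Submodule.span F (Set.range v₁) ≤ ⨆ i, E i := by
    rw [Submodule.span_le, ← hspan]
    rintro _ ⟨i, rfl⟩
    exact Submodule.subset_span (e₁ i).2
  have hs₂ : Submodule.span F (Set.range v₂) ≤ W := by
    rw [Submodule.span_le]
    rintro _ ⟨i, rfl⟩
    exact (bW i).2
  have hv : LinearIndependent F (Sum.elim v₁ v₂) := hv₁.sum_type hv₂ (h.disjoint.mono hs₁ hs₂)
  have hve : LinearIndependent F (Sum.elim v₁ v₂ ∘ e) := hv.comp _ e.injective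
  refine ⟨Sum.elim v₁ v₂ ∘ e, hve,
    hve.span_eq_top_of_card_eq_finrank' (by rw [hr, Fintype.card_fin]), ?_, ?_⟩
  · intro i hi
    obtain ⟨k, rfl⟩ := e.symm.surjective i
    rw [Function.comp_apply, Equiv.apply_symm_apply]
    rcases k with k | k
    · exact Set.mem_iUnion.1 (hb (e₁ k).2)
    · simp [e] at hi
  · intro i hi
    obtain ⟨k, rfl⟩ := e.symm.surjective i
    rw [Function.comp_apply, Equiv.apply_symm_apply]
    rcases k with k | k
    · have := k.2
      simp [e] at hi
      omega
    · exact (bW k).2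

variable {K : Type*} [Field K] [NumberField K]

theorem exists_basis_of_isPrimitiveRoot {σ : K ≃ₐ[ℚ] K} {ℓ : ℕ} [Fact ℓ.Prime]
    (hK : ∀ ζ : K, ζ ^ ℓ = 1 → ζ = 1) {A : ZMod ℓ} (hA : IsPrimitiveRoot A (orderOf σ)) {R : ℕ}
    (hR : numVanishing σ ℓ A = R) :
    ∃ u : Fin (Units.rank K) → (𝓞 K)ˣ, IsBasisMod ℓ u ∧
      (∀ i : Fin (Units.rank K), (i : ℕ) < R →
        ∃ c : ZMod ℓ, c ≠ A ∧ unitClass ℓ (u i) ∈ unitEigenspace σ ℓ c) ∧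
      (∀ i : Fin (Units.rank K), R ≤ (i : ℕ) → unitClass ℓ (u i) ∈ unitEigenspace σ ℓ A) := by
  have := finite_unitsMod Fact.out hK
  obtain ⟨v, hli, hspan, h1, h2⟩ := exists_adapted_basis
    (fun c : {c : ZMod ℓ // c ≠ A} => unitEigenspace σ ℓ c) (unitEigenspace σ ℓ A)
    (isCompl_unitEigenspace σ hA) hR (finrank_unitsMod hK)
  choose u hu using fun i => unitClass_surjective ℓ (v i)
  obtain rfl : (fun i => unitClass ℓ (u i)) = v := funext hu
  refine ⟨u, ⟨hli, hspan⟩, fun i hi => ?_, h2⟩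
  obtain ⟨c, hc⟩ := h1 i hi
  exact ⟨c, c.2, hc⟩

/-- Once the exponents `a d` are known, a line of the table follows. `hord` separates the two
reasons for `A` to have order `orderOf σ`: primality, or the Frobenius argument. -/
theorem unit_values_of_charpoly {σ : K ≃ₐ[ℚ] K} (hσ : σ ≠ 1) {row : Row} {a : ℕ → ℕ}
    (ha : (actionModTorsion σ).charpoly = ∏ d ∈ (orderOf σ).divisors, cyclotomic d ℤ ^ a d)
    (hord : (orderOf σ).Prime ∨ orderOf σ = Module.finrank ℚ K)
    (hrank : Units.rank K = row.rank) (hco : a (orderOf σ) = row.corank)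
    (hsum : row.numVanish + row.corank = row.rank)
    (hmu : ∏ d ∈ (orderOf σ).divisors with a d ≠ 0, cyclotomic d ℤ = row.mu) :
    unitMinpoly σ = row.mu ∧ Units.rank K = row.rank ∧
      ∀ (p n ℓ : ℕ) (_ : p.Prime) (_ : ℓ.Prime)
        (𝔭 : Ideal (𝓞 K)) (_ : 𝔭.IsPrime)
        (_ : Nat.card (𝓞 K ⧸ 𝔭) = p ^ n) (_ : orderOf σ ∣ n)
        (_ : (ℓ : ℤ) ∣ (cyclotomic n ℤ).eval (p : ℤ))
        (_ : ¬ ℓ ∣ orderOf σ) (_ : ∀ ζ : K, ζ ^ ℓ = 1 → ζ = 1)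
        (g : 𝓞 K ⧸ 𝔭) (_ : ∀ y : 𝓞 K ⧸ 𝔭, y ≠ 0 → ∃ k : ℕ, g ^ k = y)
        (A : ℤ) (_ : ¬ A ≡ 1 [ZMOD ℓ]) (_ : LogCompatible σ p 𝔭 g ℓ A),
        numVanishing σ ℓ (A : ZMod ℓ) = row.numVanish ∧
        Module.finrank (ZMod ℓ) (unitEigenspace σ ℓ (A : ZMod ℓ)) = row.corank ∧
        ∃ u : Fin (Units.rank K) → (𝓞 K)ˣ, IsBasisMod ℓ u ∧
          (∀ i : Fin (Units.rank K), (i : ℕ) < row.numVanish →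
            logRho 𝔭 g ℓ (u i : 𝓞 K) = 0 ∧
            ∃ c : ZMod ℓ, c ≠ (A : ZMod ℓ) ∧ unitClass ℓ (u i) ∈ unitEigenspace σ ℓ c) ∧
          (∀ i : Fin (Units.rank K), row.numVanish ≤ (i : ℕ) →
            unitClass ℓ (u i) ∈ unitEigenspace σ ℓ (A : ZMod ℓ)) := by
  refine ⟨?_, hrank, ?_⟩
  · rw [← hmu]
    exact minpoly_eq_prod_cyclotomic _ (orderOf_pos σ) (actionModTorsion_pow_orderOf σ) ha
  intro p n ℓ hp hℓ 𝔭 h𝔭 hcard hn hΦ hℓσ hK g hg A hA1 hA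
  have := Fact.mk hℓ
  have hfin : Finite (𝓞 K ⧸ 𝔭) := Nat.finite_of_card_ne_zero (hcard ▸ pow_ne_zero _ hp.ne_zero)
  have hmax := isMaximal_of_finite_quotient h𝔭 hfin
  have hn0 : n ≠ 0 := by
    rintro rfl
    have : Nontrivial (𝓞 K ⧸ 𝔭) := Ideal.Quotient.nontrivial_iff.2 h𝔭.ne_top
    exact absurd hcard (Finite.one_lt_card (α := 𝓞 K ⧸ 𝔭)).ne'
  have hσ1 : orderOf σ ≠ 1 := mt orderOf_eq_one_iff.1 hσ
  have hn2 : 2 ≤ n := by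
    have := Nat.le_of_dvd (Nat.pos_of_ne_zero hn0) hn
    have := orderOf_pos σ
    omega
  -- `n ≥ 2` gives at least four residue classes, which excludes `𝔽_2` and with it `g = 0`.
  have hF : 2 < Nat.card (𝓞 K ⧸ 𝔭) := by
    rw [hcard]
    calc 2 < 2 ^ 2 := by norm_num
      _ ≤ p ^ 2 := Nat.pow_le_pow_left hp.two_le 2
      _ ≤ p ^ n := Nat.pow_le_pow_right hp.pos hn2
  have hℓF : ℓ ∣ Nat.card (𝓞 K ⧸ 𝔭) - 1 := by
    rw [hcard, ← Int.natCast_dvd_natCast, Nat.cast_sub (Nat.one_le_pow _ _ hp.pos)]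
    have h1 := Polynomial.eval_dvd (x := (p : ℤ)) (cyclotomic.dvd_X_pow_sub_one n ℤ)
    simpa using hΦ.trans h1
  let := Ideal.Quotient.field 𝔭
  have hlog : ∀ k : ℕ, (discreteLog g (g ^ k) : ZMod ℓ) = k := discreteLog_pow hg hF hℓF
  have hg0 : g ≠ 0 := by
    rintro rfl
    have h1 := orderOf_eq_card_sub_one hg hF
    rw [orderOf_zero] at h1
    omega
  have hA1' : (A : ZMod ℓ) ≠ 1 := by
    rw [← Int.cast_one, Ne, ZMod.intCast_eq_intCast_iff]
    exact hA1
  have hprim : IsPrimitiveRoot (A : ZMod ℓ) (orderOf σ) := by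
    rcases hord with h | h
    · exact isPrimitiveRoot_of_prime h
        (pow_orderOf_eq_one_of_logCompatible hp hmax hg0 hlog hA) hA1'
    · exact isPrimitiveRoot_of_orderOf_eq_finrank h hp hmax hcard hn hn0 hΦ hℓσ hg hg0 hlog hA
  have hE : Module.finrank (ZMod ℓ) (unitEigenspace σ ℓ (A : ZMod ℓ)) = row.corank := by
    rw [finrank_unitEigenspace hK σ hℓσ hprim ha, hco]
  have hV : numVanishing σ ℓ (A : ZMod ℓ) = row.numVanish := by
    have := numVanishing_add_finrank hK σ hprim
    omega
  obtain ⟨u, hu, h1, h2⟩ := exists_basis_of_isPrimitiveRoot hK hprim hV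
  refine ⟨hV, hE, u, hu, fun i hi => ?_, h2⟩
  obtain ⟨c, hc, hmem⟩ := h1 i hi
  exact ⟨logRho_eq_zero_of_mem_unitEigenspace h𝔭 hg hlog hA hc hmem, c, hc, hmem⟩

/-! ### The exponents in terms of signatures, and the table -/

variable {K : Type*} [Field K] [NumberField K]

theorem exists_exponents (σ : K ≃ₐ[ℚ] K) : ∃ a : ℕ → ℕ,
    (actionModTorsion σ).charpoly = ∏ d ∈ (orderOf σ).divisors, cyclotomic d ℤ ^ a d ∧
    ∑ d ∈ (orderOf σ).divisors, a d * d.totient = Units.rank K ∧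
    ∀ k, k ∣ orderOf σ → ∑ d ∈ k.divisors, a d * d.totient =
      Units.rank (IntermediateField.fixedField (Subgroup.zpowers (σ ^ k))) := by
  have hT := actionModTorsion_pow_orderOf σ
  obtain ⟨a, ha⟩ := charpoly_eq_prod_cyclotomic _ (orderOf_pos σ) hT
  refine ⟨a, ha, ?_, fun k hk => ?_⟩
  · rw [← finrank_eq_sum_of_charpoly _ ha]
    exact Units.finrank_modTorsion K
  · rw [← finrank_ker_pow_sub_one _ (orderOf_pos σ) hT hk ha, ← actionModTorsion_pow,
      finrank_ker_actionModTorsion_sub_one]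

theorem divisors_two : Nat.divisors 2 = {1, 2} := rfl

theorem divisors_three : Nat.divisors 3 = {1, 3} := rfl

theorem divisors_four : Nat.divisors 4 = {1, 2, 4} := rfl

theorem divisors_six : Nat.divisors 6 = {1, 2, 3, 6} := rfl

theorem totient_three : Nat.totient 3 = 2 := rfl

theorem totient_four : Nat.totient 4 = 2 := rfl

theorem totient_six : Nat.totient 6 = 2 := rfl

theorem cyclotomic_four : cyclotomic 4 ℤ = X ^ 2 + 1 := by
  have h := cyclotomic_prime_pow_eq_geom_sum (R := ℤ) (n := 1) Nat.prime_two
  norm_num [Finset.sum_range_succ] at h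
  rw [h, add_comm]

/-- For prime order only `a 1` and `a (orderOf σ)` occur, and the unit ranks of the fixed field and
of `K` determine both. -/
theorem exists_exponents_of_prime {σ : K ≃ₐ[ℚ] K} (hp : (orderOf σ).Prime) {s t : ℕ × ℕ}
    (hs : signature K = s)
    (ht : signature (IntermediateField.fixedField (Subgroup.zpowers σ)) = t) :
    ∃ a : ℕ → ℕ,
      (actionModTorsion σ).charpoly = ∏ d ∈ (orderOf σ).divisors, cyclotomic d ℤ ^ a d ∧
      a 1 = t.1 + t.2 - 1 ∧
      a 1 + a (orderOf σ) * (orderOf σ - 1) = s.1 + s.2 - 1 := by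
  obtain ⟨a, ha, hr, hk⟩ := exists_exponents σ
  have h1 := hk 1 (one_dvd _)
  rw [pow_one, rank_eq_of_signature ht] at h1
  rw [rank_eq_of_signature hs, hp.sum_divisors, Nat.totient_prime hp] at hr
  simp at h1 hr
  exact ⟨a, ha, h1, by omega⟩

theorem orderOf_pow_eq_of_mul {G : Type*} [Group G] [Finite G] {σ : G} {k j : ℕ}
    (h : orderOf σ = k * j) : orderOf (σ ^ k) = j := by
  have hpos := orderOf_pos σ
  have hk : k ≠ 0 := by
    rintro rfl
    omega
  rw [orderOf_pow_of_dvd hk (h ▸ dvd_mul_right k j), h, Nat.mul_div_cancel_left _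
    (Nat.pos_of_ne_zero hk)]

end NFSUnits

end

theorem mainTheorem3 {K : Type*} [Field K] [NumberField K]
    (hdeg : Module.finrank ℚ K = 4 ∨ Module.finrank ℚ K = 6)
    (σ : K ≃ₐ[ℚ] K) (hσ : σ ≠ 1) :
    -- every case occurs in the table (for degree 6 and order 2: every totally complex case)
    ((Module.finrank ℚ K = 6 → orderOf σ = 2 → NFSUnits.signature K = (0, 3)) →
      ∃ row ∈ NFSUnits.table, row.Matches σ) ∧
    -- the values listed in the table are the right ones
    ∀ row ∈ NFSUnits.table, row.Matches σ →
      NFSUnits.unitMinpoly σ = row.mu ∧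
      Units.rank K = row.rank ∧
      ∀ (p n ℓ : ℕ) (_ : p.Prime) (_ : ℓ.Prime)
        (𝔭 : Ideal (𝓞 K)) (_ : 𝔭.IsPrime)
        -- the residue field of `𝔭` is the field with `p ^ n` elements
        (_ : Nat.card (𝓞 K ⧸ 𝔭) = p ^ n) (_ : orderOf σ ∣ n)
        (_ : (ℓ : ℤ) ∣ (cyclotomic n ℤ).eval (p : ℤ))
        (_ : ¬ ℓ ∣ orderOf σ) (_ : ∀ ζ : K, ζ ^ ℓ = 1 → ζ = 1)
        -- `g` generates the multiplicative group of the residue field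
        (g : 𝓞 K ⧸ 𝔭) (_ : ∀ y : 𝓞 K ⧸ 𝔭, y ≠ 0 → ∃ k : ℕ, g ^ k = y)
        (A : ℤ) (_ : ¬ A ≡ 1 [ZMOD ℓ]) (_ : NFSUnits.LogCompatible σ p 𝔭 g ℓ A),
        NFSUnits.numVanishing σ ℓ (A : ZMod ℓ) = row.numVanish ∧
        Module.finrank (ZMod ℓ) (NFSUnits.unitEigenspace σ ℓ (A : ZMod ℓ)) = row.corank ∧
        ∃ u : Fin (Units.rank K) → (𝓞 K)ˣ, NFSUnits.IsBasisMod ℓ u ∧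
          (∀ i : Fin (Units.rank K), (i : ℕ) < row.numVanish →
            NFSUnits.logRho 𝔭 g ℓ (u i : 𝓞 K) = 0 ∧
            ∃ c : ZMod ℓ, c ≠ (A : ZMod ℓ) ∧
              NFSUnits.unitClass ℓ (u i) ∈ NFSUnits.unitEigenspace σ ℓ c) ∧
          (∀ i : Fin (Units.rank K), row.numVanish ≤ (i : ℕ) →
            NFSUnits.unitClass ℓ (u i) ∈ NFSUnits.unitEigenspace σ ℓ (A : ZMod ℓ)) := by
  refine ⟨NFSUnits.exists_row_of_finrank_mem hdeg σ hσ, fun row hrow hmatch => ?_⟩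
  simp only [NFSUnits.table, List.mem_cons, List.not_mem_nil, or_false] at hrow
  rcases hrow with rfl | rfl | rfl | rfl | rfl | rfl | rfl | rfl | rfl | rfl | rfl | rfl <;>
    obtain ⟨hd, ho, hs, ht⟩ := hmatch <;> dsimp only at hd ho hs ht
  · have hp : (orderOf σ).Prime := ho ▸ by decide
    obtain ⟨a, ha, h1, hm⟩ := NFSUnits.exists_exponents_of_prime hp hs ht
    rw [ho] at hm
    simp only at h1 hm
    have h2 : a 2 = 2 := by omega
    refine NFSUnits.unit_values_of_charpoly hσ ha (Or.inl hp) (NFSUnits.rank_eq_of_signature hs)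
      (by rw [ho, h2]) rfl ?_
    rw [ho, NFSUnits.divisors_two]
    simp [Finset.filter_insert, Finset.filter_singleton, h1, h2, cyclotomic_two]
  · have hp : (orderOf σ).Prime := ho ▸ by decide
    obtain ⟨a, ha, h1, hm⟩ := NFSUnits.exists_exponents_of_prime hp hs ht
    rw [ho] at hm
    simp only at h1 hm
    have h2 : a 2 = 1 := by omega
    refine NFSUnits.unit_values_of_charpoly hσ ha (Or.inl hp) (NFSUnits.rank_eq_of_signature hs)
      (by rw [ho, h2]) rfl ?_
    rw [ho, NFSUnits.divisors_two]
    simp [Finset.filter_insert, Finset.filter_singleton, h1, h2, cyclotomic_two]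
  · have hp : (orderOf σ).Prime := ho ▸ by decide
    obtain ⟨a, ha, h1, hm⟩ := NFSUnits.exists_exponents_of_prime hp hs ht
    rw [ho] at hm
    simp only at h1 hm
    have h2 : a 2 = 1 := by omega
    refine NFSUnits.unit_values_of_charpoly hσ ha (Or.inl hp) (NFSUnits.rank_eq_of_signature hs)
      (by rw [ho, h2]) rfl ?_
    rw [ho, NFSUnits.divisors_two]
    simp [Finset.filter_insert, Finset.filter_singleton, h1, h2, cyclotomic_two]
  · have hp : (orderOf σ).Prime := ho ▸ by decide
    obtain ⟨a, ha, h1, hm⟩ := NFSUnits.exists_exponents_of_prime hp hs ht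
    rw [ho] at hm
    simp only at h1 hm
    -- The real quadratic subfield already has the full unit rank.
    have h2 : a 2 = 0 := by omega
    refine NFSUnits.unit_values_of_charpoly hσ ha (Or.inl hp) (NFSUnits.rank_eq_of_signature hs)
      (by rw [ho, h2]) rfl ?_
    rw [ho, NFSUnits.divisors_two]
    simp [Finset.filter_insert, Finset.filter_singleton, h1, h2]
  · obtain ⟨a, ha, hr, hk⟩ := NFSUnits.exists_exponents σ
    have hdσ : orderOf σ = Module.finrank ℚ K := ho.trans hd.symm
    have h1 := hk 1 (one_dvd _)
    rw [pow_one, NFSUnits.rank_eq_of_signature ht] at h1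
    rw [NFSUnits.rank_eq_of_signature hs, ho] at hr
    -- The real quadratic subfield has unit rank `1`, so `a 1 + a 2 = 1`; the remaining rank `2` is
    -- `2 * a 4`.
    have hs2 := hk 2 (ho ▸ by decide)
    have ho2 : orderOf (σ ^ 2) = 2 := NFSUnits.orderOf_pow_eq_of_mul ho
    rw [NFSUnits.rank_fixedField_of_totallyReal (k := 2) _ (by rw [ho2, hd])
      (congrArg Prod.snd hs), NFSUnits.divisors_two] at hs2
    rw [NFSUnits.divisors_four] at hr
    simp [NFSUnits.totient_four] at h1 hr hs2
    have h2 : a 2 = 1 := by omega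
    have h4 : a 4 = 1 := by omega
    refine NFSUnits.unit_values_of_charpoly hσ ha (Or.inr hdσ) (NFSUnits.rank_eq_of_signature hs)
      (by rw [ho, h4]) rfl ?_
    rw [ho, NFSUnits.divisors_four]
    simp [Finset.filter_insert, Finset.filter_singleton, h1, h2, h4,
      cyclotomic_two, NFSUnits.cyclotomic_four]
  · obtain ⟨a, ha, hr, hk⟩ := NFSUnits.exists_exponents σ
    have hdσ : orderOf σ = Module.finrank ℚ K := ho.trans hd.symm
    have h1 := hk 1 (one_dvd _)
    rw [pow_one, NFSUnits.rank_eq_of_signature ht] at h1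
    rw [NFSUnits.rank_eq_of_signature hs, ho] at hr
    rw [NFSUnits.divisors_four] at hr
    simp [NFSUnits.totient_four] at h1 hr
    -- Parity suffices: `a 1 = 0` and `a 2 + 2 * a 4 = 1`.
    have h2 : a 2 = 1 := by omega
    have h4 : a 4 = 0 := by omega
    refine NFSUnits.unit_values_of_charpoly hσ ha (Or.inr hdσ) (NFSUnits.rank_eq_of_signature hs)
      (by rw [ho, h4]) rfl ?_
    rw [ho, NFSUnits.divisors_four]
    simp [Finset.filter_insert, Finset.filter_singleton, h1, h2, h4,
      cyclotomic_two]
  · have hp : (orderOf σ).Prime := ho ▸ by decide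
    obtain ⟨a, ha, h1, hm⟩ := NFSUnits.exists_exponents_of_prime hp hs ht
    rw [ho] at hm
    simp only at h1 hm
    have h2 : a 2 = 1 := by omega
    refine NFSUnits.unit_values_of_charpoly hσ ha (Or.inl hp) (NFSUnits.rank_eq_of_signature hs)
      (by rw [ho, h2]) rfl ?_
    rw [ho, NFSUnits.divisors_two]
    simp [Finset.filter_insert, Finset.filter_singleton, h1, h2, cyclotomic_two]
  · have hp : (orderOf σ).Prime := ho ▸ by decide
    obtain ⟨a, ha, h1, hm⟩ := NFSUnits.exists_exponents_of_prime hp hs ht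
    rw [ho] at hm
    simp only at h1 hm
    have h2 : a 2 = 0 := by omega
    refine NFSUnits.unit_values_of_charpoly hσ ha (Or.inl hp) (NFSUnits.rank_eq_of_signature hs)
      (by rw [ho, h2]) rfl ?_
    rw [ho, NFSUnits.divisors_two]
    simp [Finset.filter_insert, Finset.filter_singleton, h1, h2]
  · have hp : (orderOf σ).Prime := ho ▸ by decide
    obtain ⟨a, ha, h1, hm⟩ := NFSUnits.exists_exponents_of_prime hp hs ht
    rw [ho] at hm
    simp only at h1 hm
    have h3 : a 3 = 2 := by omega
    refine NFSUnits.unit_values_of_charpoly hσ ha (Or.inl hp) (NFSUnits.rank_eq_of_signature hs)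
      (by rw [ho, h3]) rfl ?_
    rw [ho, NFSUnits.divisors_three]
    simp [Finset.filter_insert, Finset.filter_singleton, h1, h3, cyclotomic_three]
  · have hp : (orderOf σ).Prime := ho ▸ by decide
    obtain ⟨a, ha, h1, hm⟩ := NFSUnits.exists_exponents_of_prime hp hs ht
    rw [ho] at hm
    simp only at h1 hm
    have h3 : a 3 = 1 := by omega
    refine NFSUnits.unit_values_of_charpoly hσ ha (Or.inl hp) (NFSUnits.rank_eq_of_signature hs)
      (by rw [ho, h3]) rfl ?_
    rw [ho, NFSUnits.divisors_three]
    simp [Finset.filter_insert, Finset.filter_singleton, h1, h3, cyclotomic_three]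
  · obtain ⟨a, ha, hr, hk⟩ := NFSUnits.exists_exponents σ
    have hdσ : orderOf σ = Module.finrank ℚ K := ho.trans hd.symm
    have h1 := hk 1 (one_dvd _)
    rw [pow_one, NFSUnits.rank_eq_of_signature ht] at h1
    rw [NFSUnits.rank_eq_of_signature hs, ho] at hr
    -- The quadratic and cubic subfields give `a 1 + a 2 = 1` and `a 1 + 2 * a 3 = 2`; the total
    -- rank `5` then forces `a 6 = 1`.
    have hs2 := hk 2 (ho ▸ by decide)
    have ho2 : orderOf (σ ^ 2) = 3 := NFSUnits.orderOf_pow_eq_of_mul ho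
    rw [NFSUnits.rank_fixedField_of_totallyReal (k := 2) _ (by rw [ho2, hd])
      (congrArg Prod.snd hs), NFSUnits.divisors_two] at hs2
    have hs3 := hk 3 (ho ▸ by decide)
    have ho3 : orderOf (σ ^ 3) = 2 := NFSUnits.orderOf_pow_eq_of_mul ho
    rw [NFSUnits.rank_fixedField_cubic σ hdσ (by rw [ho3, hd]), NFSUnits.divisors_three] at hs3
    rw [NFSUnits.divisors_six] at hr
    simp [NFSUnits.totient_three, NFSUnits.totient_six] at h1 hr hs2 hs3
    have h2 : a 2 = 1 := by omega
    have h3 : a 3 = 1 := by omega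
    have h6 : a 6 = 1 := by omega
    refine NFSUnits.unit_values_of_charpoly hσ ha (Or.inr hdσ) (NFSUnits.rank_eq_of_signature hs)
      (by rw [ho, h6]) rfl ?_
    rw [ho, NFSUnits.divisors_six]
    simp [Finset.filter_insert, Finset.filter_singleton, h1, h2, h3, h6,
      cyclotomic_two, cyclotomic_three, cyclotomic_six]
    ring
  · obtain ⟨a, ha, hr, hk⟩ := NFSUnits.exists_exponents σ
    have hdσ : orderOf σ = Module.finrank ℚ K := ho.trans hd.symm
    have h1 := hk 1 (one_dvd _)
    rw [pow_one, NFSUnits.rank_eq_of_signature ht] at h1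
    rw [NFSUnits.rank_eq_of_signature hs, ho] at hr
    -- The totally real cubic subfield already has unit rank `2 = r`, so `a 2` and `a 6` vanish.
    have hs3 := hk 3 (ho ▸ by decide)
    have ho3 : orderOf (σ ^ 3) = 2 := NFSUnits.orderOf_pow_eq_of_mul ho
    rw [NFSUnits.rank_fixedField_cubic σ hdσ (by rw [ho3, hd]), NFSUnits.divisors_three] at hs3
    rw [NFSUnits.divisors_six] at hr
    simp [NFSUnits.totient_three, NFSUnits.totient_six] at h1 hr hs3
    have h2 : a 2 = 0 := by omega
    have h3 : a 3 = 1 := by omega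
    have h6 : a 6 = 0 := by omega
    refine NFSUnits.unit_values_of_charpoly hσ ha (Or.inr hdσ) (NFSUnits.rank_eq_of_signature hs)
      (by rw [ho, h6]) rfl ?_
    rw [ho, NFSUnits.divisors_six]
    simp [Finset.filter_insert, Finset.filter_singleton, h1, h2, h3, h6,
      cyclotomic_three]
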